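/- All rings have $1$; modules are right modules and $\mathrm{Ext}$ is computed in the category of right modules unless stated otherwise. For a finitely generated one-sided module $M$ over a ring $R$ let $j_R(M)=\inf\{i : \mathrm{Ext}^i_R(M,R)\neq 0\}$ be its grade. **Definitions.** A ring $R$ is *Auslander-Gorenstein* if it is left and right noetherian, has finite left and right injective dimension over itself, and for every finitely generated left or right module $M$, every $i\ge 0$ and every submodule $N\subseteq \mathrm{Ext}^i_R(M,R)$ one has $j_R(N)\geq i$. It is *grade-symmetric* if $j_R({}_RB)=j_R(B_R)$ for every $(R,R)$-bimodule $B$ that is finitely generated on both sides. For prime (two-sided) ideals $Q,P$ there is a *link* $Q\rightsquigarrow P$ if there is an ideal $A$ with $QP\subseteq A\subsetneq Q\cap P$ such that $(Q\cap P)/A$ is torsionfree as a left $R/Q$-module and as a right $R/P$-module; the *cliques* are the connected components of $\mathrm{Spec}\,R$ under links. A clique $C$ is *localizable* if the set $X$ of all elements of $R$ that are regular modulo every $Q\in C$ is a right and left Ore set, the right primitive ideals of $R_X$ are exactly the extensions $Q_X$ with $Q\in C$, the same holds for the left primitive ideals, and $R_X/Q_X$ is simple artinian for every $Q\in C$. A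 prime ideal $P$ is *right correct* if $\mathrm{Ext}^i_R(R/P,R)$ is torsion as a right $R/P$-module for all $i>j_R(R/P)$. It is *right localizably correct* if its clique is localizable, with corresponding Ore set $X$, $P$ is right correct, and, with $j=j_R(R/P)$, there are isomorphisms of $(R_X,R_X)$-bimodules $$\mathrm{Ext}^{j}_R(R/P,R)\otimes_R R_X\;\cong\; R_X\otimes_R \mathrm{Ext}^{j}_R(R/P,R)\;\cong\;\mathrm{Ext}^{j}_{R_X}(R_X/P_X,R_X)$$ (extending the natural $(R,R_X)$- and $(R_X,R)$-bimodule structures of the first two). **Theorem.** Let $R$ be a grade-symmetric Auslander-Gorenstein ring, and let $P$ be a right localizably correct prime ideal of $R$ with clique $C$ and corresponding Ore set $X$. Let $M$ be a right $R$-module of finite flat dimension, and put $M_X=M\otimes_R R_X$. Then for every $i\ge 0$ the right $R_X$-module $\mathrm{Ext}^i_R(R/P,M)\otimes_R R_X$ is annihilated by $P$, and there is an isomorphism of right $R_X$-modules, in particular of right $R/P$-modules, $$\mathrm{Ext}^{i}_{R}(R/P,M)\otimes_{R} R_{X}\;\cong\; \mathrm{Ext}^{i}_{R_{X}}(R_{X}/P_{X},M_{X}).$$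 -/

import Mathlib

/-
Conventions: a left module over a ring `A` is a `Module A M`, a right module over `R` is a
`Module Rᵐᵒᵖ M` (so `MulOpposite.op r • m` is `m · r`), and an `(S, R)`-bimodule is a type with
commuting actions of `S` and `Rᵐᵒᵖ`.  Two-sided ideals are `TwoSidedIdeal R`.
-/

universe u

open CategoryTheory

namespace LocExt

noncomputable section

/-! ### Ext groups and the bimodule structures on them -/

section Ext

variable (A : Type u) [Ring A]

/-- `Ext^n_A(M, D)` for (left) modules `M`, `D` over `A`; the case of right `R`-modules is
`A = Rᵐᵒᵖ`. -/
abbrev ExtGp (M D : Type u) [AddCommGroup M] [Module A M] [AddCommGroup D] [Module A D] (n : ℕ) :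
    Type u :=
  Abelian.Ext (ModuleCat.of A M) (ModuleCat.of A D) n

variable {A} {M D : Type u} [AddCommGroup M] [Module A M] [AddCommGroup D] [Module A D] {n : ℕ}

variable (A) in
/-- An action of `T` on the `A`-module `D` which commutes with that of `A`, as endomorphisms in
the category of `A`-modules. -/
def actHom {T : Type u} [Ring T] (D : Type u) [AddCommGroup D] [Module A D] [Module T D]
    [SMulCommClass A T D] (t : T) : ModuleCat.of A D ⟶ ModuleCat.of A D :=
  ModuleCat.ofHom
    { toFun := fun d => t • d
      map_add' := smul_add t
      map_smul' := fun a d => (smul_comm a t d).symm }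

section

variable {T : Type u} [Ring T] [Module T D] [SMulCommClass A T D]

theorem actHom_one : actHom A D (1 : T) = 𝟙 _ := by
  ext d; exact one_smul T d

theorem actHom_mul (s t : T) : actHom A D (s * t) = actHom A D t ≫ actHom A D s := by
  ext d; exact mul_smul s t d

theorem actHom_add (s t : T) : actHom A D (s + t) = actHom A D s + actHom A D t := by
  ext d; exact add_smul s t d

theorem actHom_zero : actHom A D (0 : T) = 0 := by
  ext d; exact zero_smul T d

/-- If `T` acts on `D` by `A`-linear maps, then `T` acts on `Ext^n_A(M, D)` by functoriality in
the second variable. -/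
instance instModuleSnd : Module T (ExtGp A M D n) where
  smul t e := Abelian.Ext.comp (X := ModuleCat.of A M) (Y := ModuleCat.of A D) e
    (Abelian.Ext.mk₀ (actHom A D t)) (add_zero n)
  one_smul e := by
    change Abelian.Ext.comp _ _ _ = _
    rw [actHom_one]
    exact Abelian.Ext.comp_mk₀_id _
  mul_smul s t e := by
    change Abelian.Ext.comp _ _ _ = Abelian.Ext.comp (Abelian.Ext.comp _ _ _) _ _
    rw [actHom_mul, Abelian.Ext.comp_assoc_of_third_deg_zero, Abelian.Ext.mk₀_comp_mk₀]
  smul_zero t := by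
    change Abelian.Ext.comp _ _ _ = 0
    rw [Abelian.Ext.zero_comp]
  smul_add t e e' := Abelian.Ext.add_comp _ _ _ _
  add_smul s t e := by
    change Abelian.Ext.comp _ _ _ = Abelian.Ext.comp _ _ _ + Abelian.Ext.comp _ _ _
    rw [actHom_add, Abelian.Ext.mk₀_add, Abelian.Ext.comp_add]
  zero_smul e := by
    change Abelian.Ext.comp _ _ _ = 0
    rw [actHom_zero, Abelian.Ext.mk₀_zero, Abelian.Ext.comp_zero]

end

section

variable {S : Type u} [Ring S] [Module S M] [SMulCommClass A S M]

/-- If `S` acts on `M` on the left by `A`-linear maps, then `Ext^n_A(M, D)` is a right `S`-module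
by (contravariant) functoriality in the first variable. -/
instance instModuleFst : Module Sᵐᵒᵖ (ExtGp A M D n) where
  smul s e := Abelian.Ext.comp (Y := ModuleCat.of A M) (Z := ModuleCat.of A D)
    (Abelian.Ext.mk₀ (actHom A M s.unop)) e (zero_add n)
  one_smul e := by
    change Abelian.Ext.comp _ _ _ = _
    rw [MulOpposite.unop_one, actHom_one]
    exact Abelian.Ext.mk₀_id_comp _
  mul_smul s t e := by
    change Abelian.Ext.comp _ _ _ = Abelian.Ext.comp _ (Abelian.Ext.comp _ _ _) _
    rw [MulOpposite.unop_mul, actHom_mul, Abelian.Ext.mk₀_comp_mk₀_assoc]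
  smul_zero s := Abelian.Ext.comp_zero _ _ _ _ _
  smul_add s e e' := Abelian.Ext.comp_add _ _ _ _
  add_smul s t e := by
    change Abelian.Ext.comp _ _ _ = Abelian.Ext.comp _ _ _ + Abelian.Ext.comp _ _ _
    rw [MulOpposite.unop_add, actHom_add, Abelian.Ext.mk₀_add, Abelian.Ext.add_comp]
  zero_smul e := by
    change Abelian.Ext.comp _ _ _ = 0
    rw [MulOpposite.unop_zero, actHom_zero, Abelian.Ext.mk₀_zero, Abelian.Ext.zero_comp]

variable {T : Type u} [Ring T] [Module T D] [SMulCommClass A T D]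

instance instSMulCommClassExt : SMulCommClass Sᵐᵒᵖ T (ExtGp A M D n) where
  smul_comm s t e := by
    change Abelian.Ext.comp _ (Abelian.Ext.comp _ _ _) _ =
      Abelian.Ext.comp (Abelian.Ext.comp _ _ _) _ _
    rw [Abelian.Ext.comp_assoc_of_third_deg_zero]

instance instSMulCommClassExt' : SMulCommClass T Sᵐᵒᵖ (ExtGp A M D n) :=
  SMulCommClass.symm _ _ _

end

end Ext

/-! ### Tensor products over a noncommutative ring -/

section Tensor

variable (R : Type u) [Ring R]

open TensorProduct in
/-- The relations `(m · r) ⊗ n = m ⊗ (r · n)`. -/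
def tensorRel (M N : Type u) [AddCommGroup M] [Module Rᵐᵒᵖ M] [AddCommGroup N] [Module R N] :
    AddSubgroup (M ⊗[ℤ] N) :=
  AddSubgroup.closure
    {x | ∃ (m : M) (r : R) (n : N), x = (MulOpposite.op r • m) ⊗ₜ[ℤ] n - m ⊗ₜ[ℤ] (r • n)}

open TensorProduct in
/-- The tensor product `M ⊗_R N` of a right module `M` and a left module `N` over `R`. -/
def NCTensor (M N : Type u) [AddCommGroup M] [Module Rᵐᵒᵖ M] [AddCommGroup N] [Module R N] :
    Type u :=
  (M ⊗[ℤ] N) ⧸ tensorRel R M N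

namespace NCTensor

variable {R}
variable {M N M' N' M'' N'' : Type u}
  [AddCommGroup M] [Module Rᵐᵒᵖ M] [AddCommGroup N] [Module R N]
  [AddCommGroup M'] [Module Rᵐᵒᵖ M'] [AddCommGroup N'] [Module R N']
  [AddCommGroup M''] [Module Rᵐᵒᵖ M''] [AddCommGroup N''] [Module R N'']

open TensorProduct in
instance : AddCommGroup (NCTensor R M N) :=
  inferInstanceAs (AddCommGroup ((M ⊗[ℤ] N) ⧸ tensorRel R M N))

open TensorProduct in
variable (R) in
/-- The pure tensor `m ⊗ n` in `M ⊗_R N`. -/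
def tmul (m : M) (n : N) : NCTensor R M N :=
  QuotientAddGroup.mk (s := tensorRel R M N) (m ⊗ₜ[ℤ] n)

theorem hom_ext {G : Type*} [AddCommGroup G] {f g : NCTensor R M N →+ G}
    (h : ∀ m n, f (tmul R m n) = g (tmul R m n)) : f = g := by
  refine QuotientAddGroup.addMonoidHom_ext _ ?_
  have : (f.comp (QuotientAddGroup.mk' (tensorRel R M N))).toIntLinearMap =
      (g.comp (QuotientAddGroup.mk' (tensorRel R M N))).toIntLinearMap := by
    ext m n
    exact h m n
  ext x
  exact LinearMap.congr_fun this x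

/-- Functoriality of the tensor product in both variables. -/
def map (f : M →ₗ[Rᵐᵒᵖ] M') (g : N →ₗ[R] N') : NCTensor R M N →+ NCTensor R M' N' :=
  QuotientAddGroup.map (tensorRel R M N) (tensorRel R M' N')
    (TensorProduct.map f.toAddMonoidHom.toIntLinearMap
      g.toAddMonoidHom.toIntLinearMap).toAddMonoidHom
    (by
      rw [tensorRel, AddSubgroup.closure_le]
      rintro x ⟨m, r, n, rfl⟩
      refine AddSubgroup.subset_closure ⟨f m, r, g n, ?_⟩
      simp)

theorem map_tmul (f : M →ₗ[Rᵐᵒᵖ] M') (g : N →ₗ[R] N') (m : M) (n : N) :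
    map f g (tmul R m n) = tmul R (f m) (g n) := rfl

theorem map_comp (f : M →ₗ[Rᵐᵒᵖ] M') (g : N →ₗ[R] N') (f' : M' →ₗ[Rᵐᵒᵖ] M'')
    (g' : N' →ₗ[R] N'') : map (f' ∘ₗ f) (g' ∘ₗ g) = (map f' g').comp (map f g) :=
  hom_ext fun _ _ => rfl

theorem map_id : map (LinearMap.id : M →ₗ[Rᵐᵒᵖ] M) (LinearMap.id : N →ₗ[R] N) =
    AddMonoidHom.id _ :=
  hom_ext fun _ _ => rfl

theorem tmul_add (m : M) (n n' : N) : tmul R m (n + n') = tmul R m n + tmul R m n' := by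
  simp only [tmul, TensorProduct.tmul_add]; rfl

theorem add_tmul (m m' : M) (n : N) : tmul R (m + m') n = tmul R m n + tmul R m' n := by
  simp only [tmul, TensorProduct.add_tmul]; rfl

theorem zero_tmul (n : N) : tmul R (0 : M) n = 0 := by
  simp only [tmul, TensorProduct.zero_tmul]; rfl

theorem tmul_zero (m : M) : tmul R m (0 : N) = 0 := by
  simp only [tmul, TensorProduct.tmul_zero]; rfl

/-- The action of an element of a commuting ring, as a linear map. -/
def lact (A : Type u) [Ring A] {T : Type u} [Ring T] {D : Type u} [AddCommGroup D] [Module A D]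
    [Module T D] [SMulCommClass A T D] (t : T) : D →ₗ[A] D where
  toFun d := t • d
  map_add' := smul_add t
  map_smul' a d := (smul_comm a t d).symm

/-- If `M` is a `(T, R)`-bimodule, then `M ⊗_R N` is a left `T`-module. -/
instance instModuleLeft {T : Type u} [Ring T] [Module T M] [SMulCommClass Rᵐᵒᵖ T M] :
    Module T (NCTensor R M N) where
  smul t x := map (lact Rᵐᵒᵖ t) LinearMap.id x
  one_smul x := DFunLike.congr_fun
    (hom_ext (f := map (lact Rᵐᵒᵖ (1 : T)) LinearMap.id) (g := AddMonoidHom.id (NCTensor R M N))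
      fun m n => by simp [map_tmul, lact]) x
  mul_smul s t x := DFunLike.congr_fun
    (hom_ext (f := map (lact Rᵐᵒᵖ (s * t)) LinearMap.id)
      (g := (map (lact Rᵐᵒᵖ s) LinearMap.id).comp (map (M := M) (N := N) (lact Rᵐᵒᵖ t)
        LinearMap.id))
      fun m n => by simp [map_tmul, lact, mul_smul]) x
  smul_zero t := map_zero (map (lact Rᵐᵒᵖ t) LinearMap.id)
  smul_add t := map_add (map (lact Rᵐᵒᵖ t) LinearMap.id)
  add_smul s t x := DFunLike.congr_fun
    (hom_ext (f := map (lact Rᵐᵒᵖ (s + t)) LinearMap.id)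
      (g := map (lact Rᵐᵒᵖ s) LinearMap.id + map (M := M) (N := N) (lact Rᵐᵒᵖ t) LinearMap.id)
      fun m n => by simp [map_tmul, lact, add_smul, add_tmul]) x
  zero_smul x := DFunLike.congr_fun
    (hom_ext (f := map (lact Rᵐᵒᵖ (0 : T)) LinearMap.id) (g := (0 : NCTensor R M N →+ _))
      fun m n => by simp [map_tmul, lact, zero_tmul]) x

/-- If `N` is an `(R, S)`-bimodule, then `M ⊗_R N` is a right `S`-module. -/
instance instModuleRight {S : Type u} [Ring S] [Module Sᵐᵒᵖ N] [SMulCommClass R Sᵐᵒᵖ N] :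
    Module Sᵐᵒᵖ (NCTensor R M N) where
  smul s x := map LinearMap.id (lact R s) x
  one_smul x := DFunLike.congr_fun
    (hom_ext (f := map LinearMap.id (lact R (1 : Sᵐᵒᵖ))) (g := AddMonoidHom.id (NCTensor R M N))
      fun m n => by simp [map_tmul, lact]) x
  mul_smul s t x := DFunLike.congr_fun
    (hom_ext (f := map LinearMap.id (lact R (s * t)))
      (g := (map LinearMap.id (lact R s)).comp (map (M := M) (N := N) LinearMap.id (lact R t)))
      fun m n => by simp [map_tmul, lact, mul_smul]) x
  smul_zero s := map_zero (map LinearMap.id (lact R s))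
  smul_add s := map_add (map LinearMap.id (lact R s))
  add_smul s t x := DFunLike.congr_fun
    (hom_ext (f := map LinearMap.id (lact R (s + t)))
      (g := map LinearMap.id (lact R s) + map (M := M) (N := N) LinearMap.id (lact R t))
      fun m n => by simp [map_tmul, lact, add_smul, tmul_add]) x
  zero_smul x := DFunLike.congr_fun
    (hom_ext (f := map LinearMap.id (lact R (0 : Sᵐᵒᵖ))) (g := (0 : NCTensor R M N →+ _))
      fun m n => by simp [map_tmul, lact, tmul_zero]) x

end NCTensor

/-- A right `R`-module `M` is flat if `M ⊗_R -` preserves injections of left `R`-modules. -/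
def IsFlatRight (M : Type u) [AddCommGroup M] [Module Rᵐᵒᵖ M] : Prop :=
  ∀ (N N' : Type u) [AddCommGroup N] [Module R N] [AddCommGroup N'] [Module R N']
    (g : N →ₗ[R] N'), Function.Injective g →
      Function.Injective (NCTensor.map (LinearMap.id : M →ₗ[Rᵐᵒᵖ] M) g)

/-- `M` has a resolution of length at most `n` by flat right modules. -/
def HasFlatResolution : ℕ → ModuleCat.{u} Rᵐᵒᵖ → Prop
  | 0, M => IsFlatRight R M
  | n + 1, M => ∃ (K F : ModuleCat.{u} Rᵐᵒᵖ) (i : K →ₗ[Rᵐᵒᵖ] F) (p : F →ₗ[Rᵐᵒᵖ] M),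
      IsFlatRight R F ∧ Function.Injective i ∧ Function.Exact i p ∧ Function.Surjective p ∧
        HasFlatResolution n K

/-- The right module `M` has finite flat dimension. -/
def HasFiniteFlatDim (M : Type u) [AddCommGroup M] [Module Rᵐᵒᵖ M] : Prop :=
  ∃ n, HasFlatResolution R n (ModuleCat.of Rᵐᵒᵖ M)

end Tensor

/-! ### Grade, Auslander-Gorenstein and grade-symmetric rings -/

/-- `inf {i | Ext^i_A(M, D) ≠ 0}` (it is `⊤` if there is no such `i`).  The grade of a left
`R`-module `M` is `grade R R M`, that of a right `R`-module is `grade Rᵐᵒᵖ R M`. -/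
def grade (A D M : Type u) [Ring A] [AddCommGroup D] [Module A D] [AddCommGroup M] [Module A M] :
    ℕ∞ :=
  ⨅ (i : ℕ) (_ : Nontrivial (ExtGp A M D i)), (i : ℕ∞)

/-- A (two-sided) noetherian ring of finite left and right injective dimension which satisfies the
Auslander condition on both sides: for every finitely generated one-sided module `M`, every `i`
and every submodule `N` of `Ext^i_R(M, R)`, the grade of `N` is at least `i`. -/
class IsAuslanderGorenstein (R : Type u) [Ring R] : Prop where
  noetherian_left : IsNoetherianRing R
  noetherian_right : IsNoetherianRing Rᵐᵒᵖ
  injDim_left : ∃ d : ℕ, HasInjectiveDimensionLE (ModuleCat.of R R) d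
  injDim_right : ∃ d : ℕ, HasInjectiveDimensionLE (ModuleCat.of Rᵐᵒᵖ R) d
  auslander_left : ∀ (M : Type u) [AddCommGroup M] [Module R M] [Module.Finite R M] (i : ℕ)
    (N : Submodule Rᵐᵒᵖ (ExtGp R M R i)), (i : ℕ∞) ≤ grade Rᵐᵒᵖ R N
  auslander_right : ∀ (M : Type u) [AddCommGroup M] [Module Rᵐᵒᵖ M] [Module.Finite Rᵐᵒᵖ M] (i : ℕ)
    (N : Submodule R (ExtGp Rᵐᵒᵖ M R i)), (i : ℕ∞) ≤ grade R R N

attribute [instance] IsAuslanderGorenstein.noetherian_left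
  IsAuslanderGorenstein.noetherian_right

/-- The left and right grades agree for every bimodule which is finitely generated on both
sides. -/
def IsGradeSymmetric (R : Type u) [Ring R] : Prop :=
  ∀ (B : Type u) [AddCommGroup B] [Module R B] [Module Rᵐᵒᵖ B] [SMulCommClass R Rᵐᵒᵖ B],
    Module.Finite R B → Module.Finite Rᵐᵒᵖ B → grade R R B = grade Rᵐᵒᵖ R B

/-! ### Factor rings, prime ideals, links and cliques -/

section Ideals

variable {R : Type u} [Ring R]

/-- The factor ring `R / I`. -/
def Quo (I : TwoSidedIdeal R) : Type u := I.ringCon.Quotient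

namespace Quo

variable (I : TwoSidedIdeal R)

instance : Ring (Quo I) := inferInstanceAs (Ring I.ringCon.Quotient)

/-- The projection `R → R / I`. -/
def mk : R →+* Quo I := I.ringCon.mk'

instance : Module R (Quo I) := Module.compHom _ (mk I)

instance : Module Rᵐᵒᵖ (Quo I) := Module.compHom _ (RingHom.op (mk I))

instance : SMulCommClass R Rᵐᵒᵖ (Quo I) where
  smul_comm r s x := mul_assoc (mk I r) x (mk I s.unop) |>.symm

instance : SMulCommClass Rᵐᵒᵖ R (Quo I) := SMulCommClass.symm _ _ _

end Quo

/-- A prime ideal of a noncommutative ring: proper, and `a R b ⊆ P` implies `a ∈ P` or `b ∈ P`. -/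
structure IsPrimeIdeal (P : TwoSidedIdeal R) : Prop where
  ne_top : P ≠ ⊤
  mem_or_mem : ∀ a b : R, (∀ r, a * r * b ∈ P) → a ∈ P ∨ b ∈ P

/-- The multiplicative set of elements of `R` that are regular (on both sides) modulo `I`. -/
def regularMod (I : TwoSidedIdeal R) : Submonoid R where
  carrier := {c | ∀ r : R, (c * r ∈ I → r ∈ I) ∧ (r * c ∈ I → r ∈ I)}
  one_mem' r := by simp
  mul_mem' {c d} hc hd r :=
    ⟨fun h => (hd r).1 ((hc (d * r)).1 (by rwa [← mul_assoc])),
      fun h => (hc r).2 ((hd (r * c)).2 (by rwa [mul_assoc]))⟩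

/-- The link `Q ⇝ P`: there is an ideal `QP ⊆ A ⊊ Q ∩ P` such that `(Q ∩ P)/A` is torsionfree as a
left `R/Q`-module and as a right `R/P`-module. -/
def Linked (Q P : TwoSidedIdeal R) : Prop :=
  IsPrimeIdeal Q ∧ IsPrimeIdeal P ∧ ∃ A : TwoSidedIdeal R,
    (∀ q ∈ Q, ∀ p ∈ P, q * p ∈ A) ∧ A < Q ⊓ P ∧
    (∀ b ∈ Q ⊓ P, ∀ c ∈ regularMod Q, c * b ∈ A → b ∈ A) ∧
    (∀ b ∈ Q ⊓ P, ∀ c ∈ regularMod P, b * c ∈ A → b ∈ A)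

/-- The clique of a prime ideal: its connected component under links. -/
def clique (P : TwoSidedIdeal R) : Set (TwoSidedIdeal R) :=
  {Q | Relation.EqvGen Linked P Q}

/-- The set `X` of elements which are regular modulo every `Q` in `C`. -/
def cliqueSet (C : Set (TwoSidedIdeal R)) : Submonoid R :=
  ⨅ Q ∈ C, regularMod Q

/-- `I` is the annihilator of a simple right module. -/
def IsRightPrimitive (I : TwoSidedIdeal R) : Prop :=
  ∃ N : ModuleCat.{u} Rᵐᵒᵖ, IsSimpleModule Rᵐᵒᵖ N ∧
    ∀ r : R, r ∈ I ↔ ∀ x : N, MulOpposite.op r • x = 0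

/-- `I` is the annihilator of a simple left module. -/
def IsLeftPrimitive (I : TwoSidedIdeal R) : Prop :=
  ∃ N : ModuleCat.{u} R, IsSimpleModule R N ∧ ∀ r : R, r ∈ I ↔ ∀ x : N, r • x = 0

end Ideals

/-! ### Ore localization -/

section Ore

variable {R : Type u} [Ring R]

/-- `X` is a left and right Ore set. -/
class IsOreSet (X : Submonoid R) : Prop where
  left_ore : ∀ (r : R), ∀ s ∈ X, ∃ (r' : R), ∃ s' ∈ X, s' * r = r' * s
  right_ore : ∀ (r : R), ∀ s ∈ X, ∃ (r' : R), ∃ s' ∈ X, r * s' = s * r'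

/-- In a left noetherian ring a left Ore set is automatically left reversible. -/
theorem left_reversible [IsNoetherianRing R] (X : Submonoid R) [IsOreSet X] (r₁ r₂ : R) (s : X)
    (h : r₁ * s = r₂ * s) : ∃ s' : X, s' * r₁ = s' * r₂ := by
  let f : ℕ →o Ideal R :=
    { toFun := fun n => LinearMap.ker (LinearMap.toSpanSingleton R R ((s : R) ^ n))
      monotone' := by
        refine monotone_nat_of_le_succ fun n x hx => ?_
        simp only [LinearMap.mem_ker, LinearMap.toSpanSingleton_apply, smul_eq_mul] at hx ⊢
        rw [pow_succ, ← mul_assoc, hx, zero_mul] }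
  obtain ⟨n, hn⟩ := monotone_stabilizes_iff_noetherian.mpr ‹IsNoetherianRing R› f
  obtain ⟨r', s', hs', e⟩ := IsOreSet.left_ore (X := X) (r₁ - r₂) _ (pow_mem s.2 n)
  have h0 : (r₁ - r₂) * (s : R) = 0 := by rw [sub_mul, h, sub_self]
  have h1 : r' ∈ f (n + 1) := by
    change r' • (s : R) ^ (n + 1) = 0
    rw [smul_eq_mul, pow_succ, ← mul_assoc, ← e, mul_assoc, h0, mul_zero]
  rw [← hn (n + 1) (Nat.le_succ n)] at h1
  have h2 : r' * (s : R) ^ n = 0 := h1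
  refine ⟨⟨s', hs'⟩, ?_⟩
  rw [h2, mul_sub] at e
  exact sub_eq_zero.mp e

instance instOreSet [IsNoetherianRing R] (X : Submonoid R) [IsOreSet X] :
    OreLocalization.OreSet X :=
  Classical.choice (OreLocalization.nonempty_oreSet_iff.mpr
    ⟨left_reversible X, fun r s => by
      obtain ⟨r', s', hs', h⟩ := IsOreSet.left_ore (X := X) r s s.2
      exact ⟨r', ⟨s', hs'⟩, h⟩⟩)

variable [IsNoetherianRing R] (X : Submonoid R) [IsOreSet X]

/-- The localization `R_X` of a noetherian ring at a two-sided Ore set. -/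
def Loc : Type u := OreLocalization X R

namespace Loc

instance : Ring (Loc X) := inferInstanceAs (Ring (OreLocalization X R))

/-- The localization map `R → R_X`. -/
def of : R →+* Loc X := OreLocalization.numeratorRingHom

instance : Module R (Loc X) := Module.compHom _ (of X)

instance : Module Rᵐᵒᵖ (Loc X) := Module.compHom _ (RingHom.op (of X))

instance : SMulCommClass R (Loc X)ᵐᵒᵖ (Loc X) where
  smul_comm r s x := mul_assoc (of X r) x s.unop |>.symm

instance : SMulCommClass Rᵐᵒᵖ (Loc X) (Loc X) where
  smul_comm r s x := mul_assoc s x (of X r.unop)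

/-- The extension `Q_X` of an ideal `Q` of `R` to `R_X`. -/
def ext (Q : TwoSidedIdeal R) : TwoSidedIdeal (Loc X) := TwoSidedIdeal.span (of X '' Q)

end Loc

/-- The clique `C`, for which `X = cliqueSet C` is a right and left Ore set, is localizable: the
right primitive ideals of `R_X`, and likewise the left primitive ones, are exactly the ideals
`Q_X` with `Q ∈ C`, and the rings `R_X / Q_X` are simple artinian. -/
structure IsLocalizable (C : Set (TwoSidedIdeal R)) [IsOreSet (cliqueSet C)] : Prop where
  right_primitive : ∀ I : TwoSidedIdeal (Loc (cliqueSet C)),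
    IsRightPrimitive I ↔ ∃ Q ∈ C, I = Loc.ext (cliqueSet C) Q
  left_primitive : ∀ I : TwoSidedIdeal (Loc (cliqueSet C)),
    IsLeftPrimitive I ↔ ∃ Q ∈ C, I = Loc.ext (cliqueSet C) Q
  simple_artinian : ∀ Q ∈ C, IsSimpleRing (Quo (Loc.ext (cliqueSet C) Q)) ∧
    IsArtinianRing (Quo (Loc.ext (cliqueSet C) Q))

end Ore

/-! ### Correct primes -/

section Correct

variable {R : Type u} [Ring R]

/-- `Ext^i_R(R/P, R)` (Ext of right modules) is torsion as a right `R/P`-module for every `i`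
greater than the grade of `R/P`. -/
def IsRightCorrect (P : TwoSidedIdeal R) : Prop :=
  ∀ i : ℕ, grade Rᵐᵒᵖ R (Quo P) < i → ∀ e : ExtGp Rᵐᵒᵖ (Quo P) R i,
    ∃ c ∈ regularMod P, MulOpposite.op c • e = 0

/-- `P` is right localizably correct; `X` is the set of elements regular modulo the clique of `P`,
which is assumed to be an Ore set.

In `bimodule_right` and `bimodule_left`, `j` is the grade of the right module `R/P`.  The
isomorphism of `E ⊗_R R_X` with the `(R_X, R_X)`-bimodule `F` is one of `(R, R_X)`-bimodules, and
that of `R_X ⊗_R E` with `F` one of `(R_X, R)`-bimodules; the left `R`-module structure of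
`E ⊗_R R_X` and the right one of `R_X ⊗_R E` then extend uniquely to `R_X`, and the isomorphisms
are ones of `(R_X, R_X)`-bimodules. -/
structure IsRightLocalizablyCorrect [IsNoetherianRing R] (P : TwoSidedIdeal R)
    [IsOreSet (cliqueSet (clique P))] : Prop where
  localizable : IsLocalizable (clique P)
  correct : IsRightCorrect P
  bimodule_right : ∀ j : ℕ, grade Rᵐᵒᵖ R (Quo P) = j →
    ∃ φ : NCTensor R (ExtGp Rᵐᵒᵖ (Quo P) R j) (Loc (cliqueSet (clique P)))
        ≃ₗ[(Loc (cliqueSet (clique P)))ᵐᵒᵖ]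
      ExtGp (Loc (cliqueSet (clique P)))ᵐᵒᵖ (Quo (Loc.ext (cliqueSet (clique P)) P))
        (Loc (cliqueSet (clique P))) j,
      ∀ (r : R) (t : NCTensor R (ExtGp Rᵐᵒᵖ (Quo P) R j) (Loc (cliqueSet (clique P)))),
        φ (r • t) = Loc.of (cliqueSet (clique P)) r • φ t
  bimodule_left : ∀ j : ℕ, grade Rᵐᵒᵖ R (Quo P) = j →
    ∃ φ : NCTensor R (Loc (cliqueSet (clique P))) (ExtGp Rᵐᵒᵖ (Quo P) R j)
        ≃ₗ[Loc (cliqueSet (clique P))]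
      ExtGp (Loc (cliqueSet (clique P)))ᵐᵒᵖ (Quo (Loc.ext (cliqueSet (clique P)) P))
        (Loc (cliqueSet (clique P))) j,
      ∀ (r : R) (t : NCTensor R (Loc (cliqueSet (clique P))) (ExtGp Rᵐᵒᵖ (Quo P) R j)),
        φ (MulOpposite.op r • t) = MulOpposite.op (Loc.of (cliqueSet (clique P)) r) • φ t

end Correct

end

end LocExt

/-! The natural map `locExtTensor` from Ext_R(R/P, M) ⊗ R_X to Ext_{R_X}(R_X/P_X, M ⊗ R_X) is shown
to be bijective, by reducing to M = R.

Right localization is exact, so the natural map commutes with the long exact sequences in M,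
connecting maps included. The five lemma along a finite flat resolution reduces the claim to flat M
= F (`locExtTensor_bijective_of_hasFlatResolution`). Over a right noetherian ring, Ext out of a
finitely generated module commutes with tensoring the coefficients by F: F ⊗ Ext(R/P, R) is Ext(R/P,
F), and likewise over R_X. This reduces flat F to M = R (`locExtTensor_bijective_of_flat`).

For M = R the group E = Ext^q(R/P, R) is a bimodule: its left action comes from the coefficients,
its right action from R/P. Localizing on the left is harmless, since R_X is flat: R_X ⊗ E is always
Ext_{R_X}(R_X/P_X, R_X) (`tensorLocExtSelf_bijective`). The theorem needs localization on the right,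
and here correctness of P enters. Below the grade everything vanishes. Above it E is torsion over
R/P, and elements regular modulo P become units in the artinian ring R_X/P_X, so again both sides
vanish. At the grade the given isomorphism need not be the natural map; but its compatibility with
the left R-action forces X to act bijectively on the left of E ⊗ R_X, and this suffices for the
natural map to be bijective (`locExtTensorSelf_bijective_of_smul_bijective`).

All the tensor-Ext isomorphisms are instances of one pairing, `extPairing`, along an exact functor.
Annihilation by P follows from P_X = P R_X. -/

noncomputable section

namespace LocExt

/-! ### Exactness of tensor products over a noncommutative ring -/

section

namespace NCTensor

variable {R : Type u} [Ring R] {M N N' N'' : Type u}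
  [AddCommGroup M] [Module Rᵐᵒᵖ M] [AddCommGroup N] [Module R N]
  [AddCommGroup N'] [Module R N'] [AddCommGroup N''] [Module R N'']

/-- The homomorphism out of a tensor product induced by a balanced biadditive map. -/
def lift {G : Type*} [AddCommGroup G] (f : M →+ N →+ G)
    (hf : ∀ m (r : R) n, f (MulOpposite.op r • m) n = f m (r • n)) : NCTensor R M N →+ G :=
  QuotientAddGroup.lift (tensorRel R M N)
    (TensorProduct.liftAddHom f fun r m n => by simp) (by
      rw [tensorRel, AddSubgroup.closure_le]
      rintro _ ⟨m, r, n, rfl⟩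
      simp [hf])

theorem smul_tmul (m : M) (r : R) (n : N) :
    tmul R (MulOpposite.op r • m) n = tmul R m (r • n) := by
  rw [← sub_eq_zero]
  exact (QuotientAddGroup.eq_zero_iff _).2 (AddSubgroup.subset_closure ⟨m, r, n, rfl⟩)

@[elab_as_elim]
theorem induction_on {p : NCTensor R M N → Prop} (x : NCTensor R M N) (h0 : p 0)
    (ht : ∀ m n, p (tmul R m n)) (ha : ∀ x y, p x → p y → p (x + y)) : p x := by
  obtain ⟨x, rfl⟩ := QuotientAddGroup.mk_surjective x
  induction x using TensorProduct.induction_on with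
  | zero => exact h0
  | tmul m n => exact ht m n
  | add x y hx hy => exact ha _ _ hx hy

/-- Lifting along the surjection `g` is well defined modulo the image of `F`, so it yields a map `l`
out of M ⊗ N'' whose composite with `H` is the projection modulo that image. -/
theorem map_exact (f : N →ₗ[R] N') (g : N' →ₗ[R] N'') (hfg : Function.Exact f g)
    (hg : Function.Surjective g) :
    Function.Exact (map (LinearMap.id : M →ₗ[Rᵐᵒᵖ] M) f)
      (map (LinearMap.id : M →ₗ[Rᵐᵒᵖ] M) g) := by
  set F := map (LinearMap.id : M →ₗ[Rᵐᵒᵖ] M) f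
  set H := map (LinearMap.id : M →ₗ[Rᵐᵒᵖ] M) g
  let q := QuotientAddGroup.mk' F.range
  have key : ∀ m a b, g a = g b → q (tmul R m a) = q (tmul R m b) := by
    intro m a b hab
    obtain ⟨c, hc⟩ := (hfg (a - b)).1 (by rw [map_sub, hab, sub_self])
    rw [← sub_eq_zero, ← map_sub]
    refine (QuotientAddGroup.eq_zero_iff _).2 ⟨tmul R m c, ?_⟩
    rw [map_tmul, hc, eq_sub_iff_add_eq, LinearMap.id_apply, ← tmul_add, sub_add_cancel]
  let σ := Function.surjInv hg
  have hσ : ∀ y, g (σ y) = y := Function.surjInv_eq hg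
  let l : NCTensor R M N'' →+ _ := lift
    (AddMonoidHom.mk' (fun m => AddMonoidHom.mk' (fun y => q (tmul R m (σ y))) (fun y z => by
        rw [← map_add, ← tmul_add]
        exact key _ _ _ (by simp [hσ])))
      (fun m m' => by ext y; simp [add_tmul]))
    (fun m r n => by
      change q _ = q _
      rw [smul_tmul]
      exact key _ _ _ (by simp [hσ]))
  have hl : l.comp H = q := hom_ext fun m n => key _ _ _ (hσ _)
  intro x
  constructor
  · intro hx
    have : q x = 0 := by rw [← hl, AddMonoidHom.comp_apply, hx, map_zero]
    exact (QuotientAddGroup.eq_zero_iff _).1 this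
  · rintro ⟨y, rfl⟩
    have : H.comp F = 0 := hom_ext fun m n => by
      simp [F, H, map_tmul, hfg.apply_apply_eq_zero, tmul_zero]
    exact DFunLike.congr_fun this y

theorem map_surjective (g : N →ₗ[R] N') (hg : Function.Surjective g) :
    Function.Surjective (map (LinearMap.id : M →ₗ[Rᵐᵒᵖ] M) g) := by
  intro x
  induction x using induction_on with
  | h0 => exact ⟨0, map_zero _⟩
  | ht m n => obtain ⟨n, rfl⟩ := hg n; exact ⟨tmul R m n, rfl⟩
  | ha x y hx hy =>
    obtain ⟨x, rfl⟩ := hx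
    obtain ⟨y, rfl⟩ := hy
    exact ⟨x + y, map_add _ _ _⟩

theorem map_bijective (g : N →ₗ[R] N') (hg : Function.Bijective g) :
    Function.Bijective (map (LinearMap.id : M →ₗ[Rᵐᵒᵖ] M) g) := by
  refine ⟨?_, map_surjective g hg.2⟩
  let e := LinearEquiv.ofBijective g hg
  refine Function.LeftInverse.injective (g := map LinearMap.id e.symm.toLinearMap) fun x => ?_
  have : (map (LinearMap.id : M →ₗ[Rᵐᵒᵖ] M) e.symm.toLinearMap).comp (map LinearMap.id g) =
      AddMonoidHom.id _ := hom_ext fun m n => by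
    simp only [AddMonoidHom.comp_apply, map_tmul]
    exact congrArg (tmul R m) (e.symm_apply_apply n)
  exact DFunLike.congr_fun this x

section

variable {S : Type u} [Ring S] {M' : Type u} [AddCommGroup M'] [Module Rᵐᵒᵖ M']
  [Module Sᵐᵒᵖ N] [SMulCommClass R Sᵐᵒᵖ N]

theorem map_id_smul (f : M →ₗ[Rᵐᵒᵖ] M') (x : Sᵐᵒᵖ) (t : NCTensor R M N) :
    map f LinearMap.id (x • t) = x • map f LinearMap.id t :=
  DFunLike.congr_fun
    (f := (map f LinearMap.id).comp (DistribSMul.toAddMonoidHom _ x))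
    (g := (DistribSMul.toAddMonoidHom _ x).comp (map f LinearMap.id))
    (hom_ext fun _ _ => rfl) t

/-- Functoriality of `M ⊗ N` in `M`, as a map of right modules. -/
def mapRight (N : Type u) [AddCommGroup N] [Module R N] [Module Sᵐᵒᵖ N] [SMulCommClass R Sᵐᵒᵖ N]
    (f : M →ₗ[Rᵐᵒᵖ] M') : NCTensor R M N →ₗ[Sᵐᵒᵖ] NCTensor R M' N where
  toFun := map f LinearMap.id
  map_add' := map_add _
  map_smul' := map_id_smul f

end

theorem map_surjective_left {M' : Type u} [AddCommGroup M'] [Module Rᵐᵒᵖ M'] (f : M →ₗ[Rᵐᵒᵖ] M')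
    (hf : Function.Surjective f) :
    Function.Surjective (map f (LinearMap.id : N →ₗ[R] N)) := by
  intro x
  induction x using induction_on with
  | h0 => exact ⟨0, map_zero _⟩
  | ht m n => obtain ⟨m, rfl⟩ := hf m; exact ⟨tmul R m n, rfl⟩
  | ha x y hx hy =>
    obtain ⟨x, rfl⟩ := hx
    obtain ⟨y, rfl⟩ := hy
    exact ⟨x + y, map_add _ _ _⟩

end NCTensor

variable {R : Type u} [Ring R] {F : Type u} [AddCommGroup F] [Module Rᵐᵒᵖ F]
  {N N' N'' : Type u} [AddCommGroup N] [Module R N]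
  [AddCommGroup N'] [Module R N'] [AddCommGroup N''] [Module R N'']

/-- Factor `g` through its range: right exactness handles the surjection, flatness the inclusion. -/
theorem IsFlatRight.exact (hF : IsFlatRight R F) (f : N →ₗ[R] N') (g : N' →ₗ[R] N'')
    (hfg : Function.Exact f g) :
    Function.Exact (NCTensor.map (LinearMap.id : F →ₗ[Rᵐᵒᵖ] F) f)
      (NCTensor.map (LinearMap.id : F →ₗ[Rᵐᵒᵖ] F) g) := by
  have h1 := NCTensor.map_exact (M := F) f g.rangeRestrict
    (fun x => by rw [← hfg x, ← Subtype.coe_inj]; rfl) g.surjective_rangeRestrict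
  have h2 := hF _ _ (LinearMap.range g).subtype Subtype.coe_injective
  intro x
  rw [← h1 x]
  have : NCTensor.map (LinearMap.id : F →ₗ[Rᵐᵒᵖ] F) g =
      (NCTensor.map LinearMap.id (LinearMap.range g).subtype).comp
        (NCTensor.map LinearMap.id g.rangeRestrict) := NCTensor.hom_ext fun _ _ => rfl
  rw [this, AddMonoidHom.comp_apply]
  exact map_eq_zero_iff _ h2

end

/-! ### Fractions, torsion and flatness for Ore localization -/

section Ore

variable {R : Type u} [Ring R]

instance instIsOreSetOp (X : Submonoid R) [IsOreSet X] : IsOreSet X.op where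
  left_ore r s hs := by
    obtain ⟨r', s', hs', h⟩ := IsOreSet.right_ore (X := X) r.unop s.unop hs
    exact ⟨MulOpposite.op r', MulOpposite.op s', hs', MulOpposite.unop_injective h⟩
  right_ore r s hs := by
    obtain ⟨r', s', hs', h⟩ := IsOreSet.left_ore (X := X) r.unop s.unop hs
    exact ⟨MulOpposite.op r', MulOpposite.op s', hs', MulOpposite.unop_injective h⟩

variable [IsNoetherianRing R] (X : Submonoid R) [IsOreSet X]

namespace Loc

variable {X}

theorem isUnit_of {s : R} (hs : s ∈ X) : IsUnit (of X s) :=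
  OreLocalization.numerator_isUnit (⟨s, hs⟩ : X)

theorem exists_of_mul_eq (x : Loc X) : ∃ r, ∃ s ∈ X, of X s * x = of X r := by
  induction x using OreLocalization.ind with
  | _ r s =>
    refine ⟨r, s, s.2, ?_⟩
    change ((s : R) /ₒ 1 : OreLocalization X R) * (r /ₒ s) = r /ₒ 1
    exact OreLocalization.mul_cancel

/-- The ring is built from left fractions; the right Ore condition turns them into right fractions.
-/
theorem exists_mul_of_eq (x : Loc X) : ∃ r, ∃ s ∈ X, x * of X s = of X r := by
  obtain ⟨r, s, hs, h⟩ := exists_of_mul_eq x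
  obtain ⟨r', s', hs', h'⟩ := IsOreSet.right_ore (X := X) r s hs
  refine ⟨r', s', hs', (isUnit_of hs).mul_left_cancel ?_⟩
  rw [← mul_assoc, h, ← map_mul, ← map_mul, h']

theorem of_eq_zero {r : R} (h : of X r = 0) : ∃ s ∈ X, s * r = 0 := by
  have h' : (r /ₒ 1 : OreLocalization X R) = 0 /ₒ 1 := h.trans OreLocalization.zero_def
  obtain ⟨u, v, h1, h2⟩ := OreLocalization.oreDiv_eq_iff.1 h'
  refine ⟨u, u.2, ?_⟩
  have h3 : (u : R) = v := by simpa using h2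
  have h4 : (0 : R) = v * r := by simpa [Submonoid.smul_def] using h1
  rw [h3, ← h4]

/-- The universal property of the localization. -/
theorem exists_lift {T : Type*} [Ring T] (f : R →+* T) (hf : ∀ s ∈ X, IsUnit (f s)) :
    ∃ g : Loc X →+* T, ∀ r, g (of X r) = f r :=
  ⟨OreLocalization.universalHom f (IsUnit.liftRight (f.toMonoidHom.comp X.subtype)
    fun s => hf s s.2) fun _ => rfl, fun _ => OreLocalization.universalHom_commutes _ _ _⟩

end Loc

namespace NCTensor

variable {X}
variable {M N N' : Type u} [AddCommGroup M] [Module Rᵐᵒᵖ M] [AddCommGroup N] [Module R N]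
  [AddCommGroup N'] [Module R N']

theorem smul_tmul_right (x y : Loc X) (m : M) :
    MulOpposite.op y • tmul R m x = tmul R m (x * y) := rfl

theorem smul_tmul_left (x y : Loc X) (n : N) :
    x • tmul R y n = tmul R (x * y) n := rfl

/-- In `M ⊗ R_X` every element has a denominator. -/
theorem exists_smul_eq_tmul_one (t : NCTensor R M (Loc X)) :
    ∃ m : M, ∃ s ∈ X, MulOpposite.op (Loc.of X s) • t = tmul R m 1 := by
  induction t using NCTensor.induction_on with
  | h0 => exact ⟨0, 1, X.one_mem, by rw [smul_zero, zero_tmul]⟩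
  | ht m x =>
    obtain ⟨r, s, hs, h⟩ := Loc.exists_mul_of_eq x
    refine ⟨MulOpposite.op r • m, s, hs, ?_⟩
    rw [smul_tmul_right, h, smul_tmul]
    exact congrArg _ (mul_one _).symm
  | ha t t' ht ht' =>
    obtain ⟨m, s, hs, h⟩ := ht
    obtain ⟨m', s', hs', h'⟩ := ht'
    -- The common right denominator is s b = s' a; it lies in `X` because s and b do, although a
    -- need not.
    obtain ⟨a, b, hb, e⟩ := IsOreSet.right_ore (X := X) s s' hs'
    have key : ∀ (m : M) (r : R), MulOpposite.op (Loc.of X r) • tmul R m (1 : Loc X) =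
        tmul R (MulOpposite.op r • m) 1 := fun m r => by
      rw [smul_tmul_right, smul_tmul, one_mul]
      exact congrArg _ (mul_one _).symm
    refine ⟨MulOpposite.op b • m + MulOpposite.op a • m', s * b, X.mul_mem hs hb, ?_⟩
    rw [smul_add, add_tmul, ← key, ← key, ← h, ← h', ← mul_smul, ← mul_smul, ← MulOpposite.op_mul,
      ← MulOpposite.op_mul, ← map_mul, ← map_mul, e]

/-- In `R_X ⊗ N` every element has a denominator. -/
theorem exists_smul_eq_one_tmul (t : NCTensor R (Loc X) N) :
    ∃ n : N, ∃ s ∈ X, Loc.of X s • t = tmul R 1 n := by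
  have key : ∀ (n : N) (r : R), Loc.of X r • tmul R (1 : Loc X) n = tmul R 1 (r • n) :=
    fun n r => by
      rw [smul_tmul_left, ← smul_tmul, mul_one]
      exact congrArg (tmul R · n) (one_mul _).symm
  induction t using NCTensor.induction_on with
  | h0 => exact ⟨0, 1, X.one_mem, by rw [smul_zero, tmul_zero]⟩
  | ht x n =>
    obtain ⟨r, s, hs, h⟩ := Loc.exists_of_mul_eq x
    refine ⟨r • n, s, hs, ?_⟩
    rw [smul_tmul_left, h, ← key, smul_tmul_left, mul_one]
  | ha t t' ht ht' =>
    obtain ⟨m, s, hs, h⟩ := ht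
    obtain ⟨m', s', hs', h'⟩ := ht'
    obtain ⟨a, b, hb, e⟩ := IsOreSet.left_ore (X := X) s s' hs'
    refine ⟨b • m + a • m', b * s, X.mul_mem hb hs, ?_⟩
    rw [smul_add, tmul_add, ← key, ← key, ← h, ← h', ← mul_smul, ← mul_smul,
      ← map_mul, ← map_mul, e]

theorem eq_zero_of_smul_op {t : NCTensor R M (Loc X)} {s : R} (hs : s ∈ X)
    (h : MulOpposite.op (Loc.of X s) • t = 0) : t = 0 := by
  obtain ⟨u, hu⟩ := Loc.isUnit_of hs
  have := congrArg (MulOpposite.op (↑u⁻¹ : Loc X) • ·) h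
  simpa [← mul_smul, ← MulOpposite.op_mul, ← hu] using this

theorem eq_zero_of_smul {V : Type*} [AddCommGroup V] [Module (Loc X) V] {t : V} {s : R}
    (hs : s ∈ X) (h : Loc.of X s • t = 0) : t = 0 :=
  (Loc.isUnit_of hs).smul_eq_zero.1 h

/-- The kernel of `N → R_X ⊗ N` is the torsion of `N`. -/
theorem exists_smul_eq_zero {n : N} (h : tmul R (1 : Loc X) n = 0) : ∃ s ∈ X, s • n = 0 := by
  let _ : Module (Loc X) (OreLocalization X N) :=
    inferInstanceAs (Module (OreLocalization X R) (OreLocalization X N))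
  have hs : ∀ (r : R) (n : N), Loc.of X r • (n /ₒ 1 : OreLocalization X N) = (r • n) /ₒ 1 :=
    fun r n => OreLocalization.smul_div_one
  -- Map to the module of left fractions, where the vanishing of n/1 is torsion by construction.
  let g : NCTensor R (Loc X) N →+ OreLocalization X N := lift
    (AddMonoidHom.mk' (fun x => AddMonoidHom.mk' (fun n => x • (n /ₒ 1 : OreLocalization X N))
      fun n n' => by rw [← smul_add, OreLocalization.add_oreDiv])
      fun x y => by ext n; exact add_smul _ _ _)
    (fun x r n => by
      change (x * Loc.of X r) • (n /ₒ 1 : OreLocalization X N) =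
        x • ((r • n) /ₒ 1 : OreLocalization X N)
      rw [mul_smul, hs])
  have h1 : (1 : Loc X) • (n /ₒ 1 : OreLocalization X N) = 0 := by
    change g (tmul R 1 n) = 0
    rw [h, map_zero]
  rw [one_smul, OreLocalization.zero_def] at h1
  obtain ⟨u, v, h1, h2⟩ := OreLocalization.oreDiv_eq_iff.1 h1
  refine ⟨u, u.2, ?_⟩
  have h3 : (u : R) = v := by simpa using h2
  have h4 : (0 : N) = v • n := by simpa using h1
  rw [h3, ← h4]

/-- The kernel of `M → M ⊗ R_X` is the torsion of `M`. -/
theorem exists_op_smul_eq_zero [IsNoetherianRing Rᵐᵒᵖ] {m : M} (h : tmul R m (1 : Loc X) = 0) :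
    ∃ s ∈ X, MulOpposite.op s • m = 0 := by
  -- Right fractions of `M` are left fractions over the opposite ring. The ring acting on `W` is
  -- built from `Rᵐᵒᵖ`, so the action of R_X on `W` is obtained from the universal property:
  -- elements of `X` act invertibly.
  let W := OreLocalization X.op M
  let f₀ : Rᵐᵒᵖ →+* AddMonoid.End W :=
    (Module.toAddMonoidEnd (OreLocalization X.op Rᵐᵒᵖ) W).comp OreLocalization.numeratorRingHom
  let f : R →+* (AddMonoid.End W)ᵐᵒᵖ := f₀.op.comp (RingEquiv.opOp R).toRingHom
  have hf : ∀ (r : R) (m : M), (f r).unop (m /ₒ 1) = ((MulOpposite.op r • m) /ₒ 1 : W) :=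
    fun r m => OreLocalization.smul_div_one
  have hu : ∀ s ∈ X, IsUnit (f s) := fun s hs => by
    have h : IsUnit (f₀ (MulOpposite.op s)) :=
      (OreLocalization.numerator_isUnit (⟨MulOpposite.op s, hs⟩ : X.op)).map
        (Module.toAddMonoidEnd (OreLocalization X.op Rᵐᵒᵖ) W)
    exact h.op
  obtain ⟨g, hg⟩ := Loc.exists_lift f hu
  let l : NCTensor R M (Loc X) →+ W := lift
    (AddMonoidHom.mk' (fun m => AddMonoidHom.mk' (fun x => (g x).unop (m /ₒ 1 : W))
      fun x y => by rw [map_add, MulOpposite.unop_add]; rfl)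
      fun m m' => by
        ext x
        change (g x).unop ((m + m') /ₒ 1 : W) = (g x).unop (m /ₒ 1 : W) + (g x).unop (m' /ₒ 1 : W)
        rw [← map_add, OreLocalization.add_oreDiv])
    (fun m r x => by
      change (g x).unop ((MulOpposite.op r • m) /ₒ 1 : W) = (g (Loc.of X r * x)).unop (m /ₒ 1 : W)
      rw [map_mul, hg, ← hf]
      rfl)
  have h1 : (m /ₒ 1 : W) = 0 := by
    have : l (tmul R m 1) = 0 := by rw [h, map_zero]
    have e : l (tmul R m 1) = (g 1).unop (m /ₒ 1 : W) := rfl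
    rwa [e, map_one] at this
  rw [OreLocalization.zero_def] at h1
  obtain ⟨u, v, h1, h2⟩ := OreLocalization.oreDiv_eq_iff.1 h1
  refine ⟨u.1.unop, u.2, ?_⟩
  have h3 : (u : Rᵐᵒᵖ) = v := by simpa using h2
  have h4 : (0 : M) = v • m := by simpa using h1
  rw [MulOpposite.op_unop, h3, ← h4]

end NCTensor

/-- `R_X` is a flat right `R`-module. -/
theorem Loc.isFlatRight : IsFlatRight R (Loc X) := by
  intro N N' _ _ _ _ g hg
  rw [injective_iff_map_eq_zero]
  intro t ht
  obtain ⟨n, s, hs, e⟩ := NCTensor.exists_smul_eq_one_tmul t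
  have h1 : NCTensor.tmul R (1 : Loc X) (g n) = 0 := by
    have h2 : NCTensor.map (LinearMap.id : Loc X →ₗ[Rᵐᵒᵖ] Loc X) g (Loc.of X s • t) =
        Loc.of X s • NCTensor.map LinearMap.id g t :=
      DFunLike.congr_fun (f := (NCTensor.map LinearMap.id g).comp
        (DistribSMul.toAddMonoidHom _ (Loc.of X s))) (g := (DistribSMul.toAddMonoidHom _
          (Loc.of X s)).comp (NCTensor.map LinearMap.id g)) (NCTensor.hom_ext fun _ _ => rfl) t
    rw [ht, smul_zero, e] at h2
    exact h2
  obtain ⟨s', hs', h3⟩ := NCTensor.exists_smul_eq_zero h1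
  rw [← map_smul, map_eq_zero_iff g hg] at h3
  refine NCTensor.eq_zero_of_smul hs (NCTensor.eq_zero_of_smul hs' ?_)
  rw [e, NCTensor.smul_tmul_left, mul_one]
  have := NCTensor.smul_tmul (1 : Loc X) s' n
  rw [h3, NCTensor.tmul_zero] at this
  rw [← this]
  exact congrArg (NCTensor.tmul R · n) (one_mul _).symm

/-- The localization of a right noetherian ring is right noetherian. -/
instance Loc.instIsNoetherianRingOp [IsNoetherianRing Rᵐᵒᵖ] : IsNoetherianRing (Loc X)ᵐᵒᵖ := by
  -- Contraction of right ideals to `R` reflects inclusions, since every element of R_X becomes an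
  -- element of `R` after multiplication by a unit coming from `X`.
  let f : Rᵐᵒᵖ →+* (Loc X)ᵐᵒᵖ := (Loc.of X).op
  refine (isNoetherian_iff' ..).2 ((OrderEmbedding.ofMapLEIff (Ideal.comap f) fun I J => ?_)
    |>.wellFoundedGT)
  refine ⟨fun h x hx => ?_, fun h => Ideal.comap_mono h⟩
  obtain ⟨r, s, hs, e⟩ := Loc.exists_mul_of_eq x.unop
  have h1 : f (MulOpposite.op r) = MulOpposite.op (Loc.of X s) * x := MulOpposite.unop_injective e.symm
  have h2 : MulOpposite.op r ∈ Ideal.comap f I := by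
    rw [Ideal.mem_comap, h1]; exact I.mul_mem_left _ hx
  have h3 := h h2
  rw [Ideal.mem_comap, h1] at h3
  exact (Ideal.unit_mul_mem_iff_mem J (Loc.isUnit_of hs).op).1 h3

end Ore

/-! ### Localization of right modules as an exact functor -/

section

variable {R : Type u} [Ring R] [IsNoetherianRing R] (X : Submonoid R) [IsOreSet X]

namespace NCTensor

variable {X} {M : Type u} [AddCommGroup M] [Module Rᵐᵒᵖ M]

theorem op_smul_tmul_one (m : M) (r : R) :
    MulOpposite.op (Loc.of X r) • tmul R m (1 : Loc X) = tmul R (MulOpposite.op r • m) 1 := by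
  rw [smul_tmul_right, smul_tmul, one_mul]
  exact congrArg _ (mul_one _).symm

theorem eq_tmul_of_smul_eq {t : NCTensor R M (Loc X)} {m : M} {s : R} (hs : s ∈ X)
    (h : MulOpposite.op (Loc.of X s) • t = tmul R m 1) : ∃ x : Loc X, t = tmul R m x := by
  obtain ⟨u, hu⟩ := Loc.isUnit_of hs
  refine ⟨↑u⁻¹, ?_⟩
  calc t = MulOpposite.op (↑u⁻¹ : Loc X) • MulOpposite.op (↑u : Loc X) • t := by
        rw [← mul_smul, ← MulOpposite.op_mul, Units.mul_inv, MulOpposite.op_one, one_smul]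
    _ = tmul R m ↑u⁻¹ := by rw [hu, h, smul_tmul_right, one_mul]

/-- Clear the denominator of `t` to get m ⊗ 1. Its image f(m) ⊗ 1 vanishes, so f(m) is killed by
some s' in `X`, and m s' replaces m. Exactness of right localization follows from this description
of kernels. -/
theorem exists_of_map_eq_zero [IsNoetherianRing Rᵐᵒᵖ] {M' : Type u} [AddCommGroup M']
    [Module Rᵐᵒᵖ M'] (f : M →ₗ[Rᵐᵒᵖ] M') (t : NCTensor R M (Loc X))
    (ht : map f LinearMap.id t = 0) : ∃ m : M, ∃ x : Loc X, f m = 0 ∧ t = tmul R m x := by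
  obtain ⟨m, s, hs, e⟩ := exists_smul_eq_tmul_one t
  have h1 := congrArg (map f LinearMap.id) e
  rw [map_id_smul, ht, smul_zero] at h1
  obtain ⟨s', hs', h2⟩ := exists_op_smul_eq_zero h1.symm
  obtain ⟨x, hx⟩ := eq_tmul_of_smul_eq (t := t) (m := MulOpposite.op s' • m)
    (X.mul_mem hs hs') (by rw [map_mul, MulOpposite.op_mul, mul_smul, e, op_smul_tmul_one])
  exact ⟨MulOpposite.op s' • m, x, (map_smul f _ _).trans h2, hx⟩

theorem map_exact_loc [IsNoetherianRing Rᵐᵒᵖ] {M' M'' : Type u} [AddCommGroup M']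
    [Module Rᵐᵒᵖ M'] [AddCommGroup M''] [Module Rᵐᵒᵖ M''] (f : M →ₗ[Rᵐᵒᵖ] M')
    (g : M' →ₗ[Rᵐᵒᵖ] M'') (h : Function.Exact f g) :
    Function.Exact (map f (LinearMap.id : Loc X →ₗ[R] Loc X))
      (map g (LinearMap.id : Loc X →ₗ[R] Loc X)) := by
  refine fun t => ⟨fun ht => ?_, ?_⟩
  · obtain ⟨m, x, h1, rfl⟩ := exists_of_map_eq_zero g t ht
    obtain ⟨m', rfl⟩ := (h m).1 h1
    exact ⟨tmul R m' x, rfl⟩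
  · rintro ⟨t, rfl⟩
    exact DFunLike.congr_fun (f := (map g LinearMap.id).comp (map f LinearMap.id)) (g := 0)
      (hom_ext fun m n => by simp [map_tmul, h.apply_apply_eq_zero, zero_tmul]) t

theorem map_injective_loc [IsNoetherianRing Rᵐᵒᵖ] {M' : Type u} [AddCommGroup M']
    [Module Rᵐᵒᵖ M'] (f : M →ₗ[Rᵐᵒᵖ] M') (h : Function.Injective f) :
    Function.Injective (map f (LinearMap.id : Loc X →ₗ[R] Loc X)) := by
  refine (injective_iff_map_eq_zero _).2 fun t ht => ?_
  obtain ⟨m, x, h1, rfl⟩ := exists_of_map_eq_zero f t ht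
  rw [(map_eq_zero_iff _ h).1 h1, zero_tmul]

end NCTensor

/-- Localization `M ↦ M ⊗ R_X` of right modules. -/
def locFunctor : ModuleCat.{u} Rᵐᵒᵖ ⥤ ModuleCat.{u} (Loc X)ᵐᵒᵖ where
  obj M := ModuleCat.of _ (NCTensor R M (Loc X))
  map f := ModuleCat.ofHom (NCTensor.mapRight (Loc X) f.hom)
  map_id M := ModuleCat.hom_ext <| LinearMap.ext fun t =>
    DFunLike.congr_fun (NCTensor.map_id (R := R) (M := M) (N := Loc X)) t
  map_comp f g := ModuleCat.hom_ext <| LinearMap.ext fun t =>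
    DFunLike.congr_fun (NCTensor.map_comp f.hom LinearMap.id g.hom LinearMap.id) t

instance : (locFunctor X).Additive where
  map_add {M M' f g} := by
    have h : NCTensor.map (f + g).hom (LinearMap.id : Loc X →ₗ[R] Loc X) =
        NCTensor.map f.hom LinearMap.id + NCTensor.map g.hom LinearMap.id :=
      NCTensor.hom_ext fun m x => by simp [NCTensor.map_tmul, NCTensor.add_tmul]
    exact ModuleCat.hom_ext (LinearMap.ext fun t => DFunLike.congr_fun h t)

variable [IsNoetherianRing Rᵐᵒᵖ]

theorem locFunctor_shortExact (S : ShortComplex (ModuleCat.{u} Rᵐᵒᵖ)) (hS : S.ShortExact) :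
    (S.map (locFunctor X)).ShortExact := by
  have hf := (ModuleCat.mono_iff_injective _).1 hS.mono_f
  have hg := (ModuleCat.epi_iff_surjective _).1 hS.epi_g
  have hx := (ShortComplex.ShortExact.moduleCat_exact_iff_function_exact S).1 hS.exact
  exact ShortComplex.ShortExact.mk'
    ((ShortComplex.ShortExact.moduleCat_exact_iff_function_exact _).2
      (NCTensor.map_exact_loc S.f.hom S.g.hom hx))
    ((ModuleCat.mono_iff_injective _).2 (NCTensor.map_injective_loc S.f.hom hf))
    ((ModuleCat.epi_iff_surjective _).2 (NCTensor.map_surjective_left S.g.hom hg))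

theorem locFunctor_preservesFinite : Limits.PreservesFiniteLimits (locFunctor X) ∧
    Limits.PreservesFiniteColimits (locFunctor X) :=
  (Functor.exact_tfae (locFunctor X)).out 0 3 |>.1 (locFunctor_shortExact X)

instance : Limits.PreservesFiniteLimits (locFunctor X) := (locFunctor_preservesFinite X).1

instance : Limits.PreservesFiniteColimits (locFunctor X) := (locFunctor_preservesFinite X).2

end

/-! ### Yoneda products as linear maps -/

section ExtMaps

variable {A : Type u} [Ring A] {N N' D D' : Type u} [AddCommGroup N] [Module A N]
  [AddCommGroup N'] [Module A N'] [AddCommGroup D] [Module A D] [AddCommGroup D'] [Module A D']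

/-- Yoneda product with a class in `Ext(N, N')`. -/
def extPrecomp (T : Type u) [Ring T] [Module T D] [SMulCommClass A T D] {a b k : ℕ}
    (c : ExtGp A N N' a) (h : a + b = k) : ExtGp A N' D b →ₗ[T] ExtGp A N D k where
  toFun e := c.comp e h
  map_add' _ _ := Abelian.Ext.comp_add _ _ _ _
  map_smul' _ e := (Abelian.Ext.comp_assoc_of_third_deg_zero c e _ h).symm

/-- Yoneda product with a class in `Ext(D, D')`. -/
def extPostcomp (S : Type u) [Ring S] [Module S N] [SMulCommClass A S N] {a b k : ℕ}
    (c : ExtGp A D D' b) (h : a + b = k) : ExtGp A N D a →ₗ[Sᵐᵒᵖ] ExtGp A N D' k where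
  toFun e := e.comp c h
  map_add' e e' := Abelian.Ext.add_comp _ _ _ _
  map_smul' s e := Abelian.Ext.comp_assoc (Abelian.Ext.mk₀ _) e c _ h (by omega)

end ExtMaps

/-! ### The pairing of F ⊗ Ext with Ext along an exact functor -/

section Pairing

open Limits

variable {A A' : Type u} [Ring A] [Ring A'] (L : ModuleCat.{u} A ⥤ ModuleCat.{u} A')
  [L.Additive] [PreservesFiniteLimits L] [PreservesFiniteColimits L]
  {R : Type u} [Ring R] {F : Type u} [AddCommGroup F] [Module Rᵐᵒᵖ F]
  {D : Type u} [AddCommGroup D] [Module A D] [Module R D] [SMulCommClass A R D]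
  {D' : Type u} [AddCommGroup D'] [Module A' D']
  (m : F →+ (L.obj (ModuleCat.of A D) ⟶ ModuleCat.of A' D'))
  (hm : ∀ (f : F) (r : R), m (MulOpposite.op r • f) = L.map (actHom A D r) ≫ m f)

/-- The map `F ⊗ Ext_A(N, D) → Ext_{A'}(L N, D')` induced by an exact functor `L` and a balanced
family `m` of homomorphisms `L D → D'`. -/
def extPairing (N : Type u) [AddCommGroup N] [Module A N] (q : ℕ) :
    NCTensor R F (ExtGp A N D q) →+
      Abelian.Ext (L.obj (ModuleCat.of A N)) (ModuleCat.of A' D') q :=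
  NCTensor.lift
    (AddMonoidHom.mk' (fun f => AddMonoidHom.mk'
      (fun e => (e.mapExactFunctor L).comp (Abelian.Ext.mk₀ (m f)) (add_zero q))
      fun e e' => by rw [Abelian.Ext.mapExactFunctor_add, Abelian.Ext.add_comp])
      fun f f' => by
        ext e : 1
        simp [Abelian.Ext.mk₀_add])
    (fun f r e => by
      change (e.mapExactFunctor L).comp (Abelian.Ext.mk₀ (m (MulOpposite.op r • f)))
          (add_zero q) =
        ((e.comp (Abelian.Ext.mk₀ (actHom A D r)) (add_zero q)).mapExactFunctor L).comp
          (Abelian.Ext.mk₀ (m f)) (add_zero q)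
      rw [Abelian.Ext.mapExactFunctor_comp, Abelian.Ext.mapExactFunctor_mk₀,
        Abelian.Ext.comp_assoc_of_third_deg_zero, Abelian.Ext.mk₀_comp_mk₀, hm])

theorem extPairing_tmul (N : Type u) [AddCommGroup N] [Module A N] (q : ℕ) (f : F)
    (e : ExtGp A N D q) : extPairing L m hm N q (NCTensor.tmul R f e) =
      (e.mapExactFunctor L).comp (Abelian.Ext.mk₀ (m f)) (add_zero q) := rfl

variable {N N' : Type u} [AddCommGroup N] [Module A N] [AddCommGroup N'] [Module A N']

/-- Naturality in the first variable. Degree 0 classes give functoriality; the class of a short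
exact sequence gives compatibility with connecting maps. -/
theorem extPairing_precomp {a b k : ℕ} (c : ExtGp A N N' a) (h : a + b = k)
    (t : NCTensor R F (ExtGp A N' D b)) :
    extPairing L m hm N k (NCTensor.map LinearMap.id (extPrecomp R c h) t) =
      (c.mapExactFunctor L).comp (extPairing L m hm N' b t) h :=
  DFunLike.congr_fun
    (f := (extPairing L m hm N k).comp (NCTensor.map LinearMap.id (extPrecomp R c h)))
    (g := (AddMonoidHom.mk' (fun y => (c.mapExactFunctor L).comp y h)
      fun _ _ => Abelian.Ext.comp_add _ _ _ _).comp (extPairing L m hm N' b))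
    (NCTensor.hom_ext fun f e => by
      change ((c.comp e h).mapExactFunctor L).comp (Abelian.Ext.mk₀ (m f)) (add_zero k) =
        (c.mapExactFunctor L).comp ((e.mapExactFunctor L).comp (Abelian.Ext.mk₀ (m f))
          (add_zero b)) h
      rw [Abelian.Ext.mapExactFunctor_comp, Abelian.Ext.comp_assoc_of_third_deg_zero]) t

section Base

variable (u : L.obj (ModuleCat.of A A))

variable (D) in
/-- `D → Ext^0(A, D)`. -/
def toExtZero (R : Type u) [Ring R] [Module R D] [SMulCommClass A R D] :
    D →ₗ[R] ExtGp A A D 0 where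
  toFun d := Abelian.Ext.mk₀ (ModuleCat.ofHom (LinearMap.toSpanSingleton A D d))
  map_add' d d' := by
    rw [← Abelian.Ext.mk₀_add]
    congr 1
    ext
    simp
  map_smul' r d := by
    change _ = Abelian.Ext.comp _ _ _
    rw [Abelian.Ext.mk₀_comp_mk₀]
    congr 1
    ext
    simp [actHom]

theorem toExtZero_bijective : Function.Bijective (toExtZero (A := A) D R) := by
  refine (Abelian.Ext.mk₀_bijective _ _).comp ⟨fun d d' h => ?_, fun g => ?_⟩
  · have := ConcreteCategory.congr_hom h (1 : A)
    simpa using this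
  · refine ⟨g.hom 1, ?_⟩
    ext
    simp

/-- Since `u` freely generates the image of A, evaluation at `u` identifies Hom(L A, D') with D',
and the pairing becomes `β`. -/
theorem extPairing_base_bijective
    (hu : Function.Bijective (LinearMap.toSpanSingleton A' (L.obj (ModuleCat.of A A)) u))
    (β : NCTensor R F D →+ D') (hβ : Function.Bijective β)
    (hβm : ∀ f d, β (NCTensor.tmul R f d) =
      (m f).hom ((L.map (ModuleCat.ofHom (LinearMap.toSpanSingleton A D d))).hom u)) :
    Function.Bijective (extPairing L m hm A 0) := by
  let ev : Abelian.Ext (L.obj (ModuleCat.of A A)) (ModuleCat.of A' D') 0 →+ D' :=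
    (AddMonoidHom.mk' (fun g : L.obj (ModuleCat.of A A) ⟶ ModuleCat.of A' D' => g.hom u)
      fun g g' => rfl).comp Abelian.Ext.addEquiv₀.toAddMonoidHom
  have hev : Function.Bijective ev := by
    refine Function.Bijective.comp (g := fun g : L.obj (ModuleCat.of A A) ⟶ ModuleCat.of A' D' =>
      g.hom u) ⟨fun g g' h => ?_, fun d => ?_⟩ Abelian.Ext.addEquiv₀.bijective
    · ext x
      obtain ⟨a, rfl⟩ := hu.2 x
      change g.hom (a • u) = g'.hom (a • u)
      rw [map_smul, map_smul]
      exact congrArg (a • ·) h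
    · let e := LinearEquiv.ofBijective _ hu
      refine ⟨ModuleCat.ofHom (LinearMap.toSpanSingleton A' D' d ∘ₗ e.symm.toLinearMap), ?_⟩
      have h1 : e.symm u = 1 := by
        rw [LinearEquiv.symm_apply_eq]
        exact (one_smul A' u).symm
      change e.symm u • d = d
      rw [h1, one_smul]
  have hcomp : (ev.comp (extPairing L m hm A 0)).comp
      (NCTensor.map LinearMap.id (toExtZero D R)) = β := NCTensor.hom_ext fun f d => by
    rw [hβm]
    change (Abelian.Ext.addEquiv₀ (((Abelian.Ext.mk₀ _).mapExactFunctor L).comp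
      (Abelian.Ext.mk₀ (m f)) (add_zero 0))).hom u = _
    rw [Abelian.Ext.mapExactFunctor_mk₀, Abelian.Ext.mk₀_comp_mk₀,
      show Abelian.Ext.mk₀ _ = Abelian.Ext.addEquiv₀.symm _ from rfl, AddEquiv.apply_symm_apply]
    rfl
  have h1 := NCTensor.map_bijective (M := F) _ (toExtZero_bijective (A := A) (D := D) (R := R))
  rw [← hcomp, AddMonoidHom.coe_comp] at hβ
  have h2 := (Function.Bijective.of_comp_iff _ h1).1 hβ
  exact (Function.Bijective.of_comp_iff' hev _).1 h2

end Base

end Pairing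

/-! ### Bijectivity of the pairing for finitely generated modules -/

section Pairing

open Limits Abelian

variable {A A' : Type u} [Ring A] [Ring A'] (L : ModuleCat.{u} A ⥤ ModuleCat.{u} A')
  [L.Additive] [PreservesFiniteLimits L] [PreservesFiniteColimits L]
  {R : Type u} [Ring R] {F : Type u} [AddCommGroup F] [Module Rᵐᵒᵖ F]
  {D : Type u} [AddCommGroup D] [Module A D] [Module R D] [SMulCommClass A R D]
  {D' : Type u} [AddCommGroup D'] [Module A' D']
  (m : F →+ (L.obj (ModuleCat.of A D) ⟶ ModuleCat.of A' D'))
  (hm : ∀ (f : F) (r : R), m (MulOpposite.op r • f) = L.map (actHom A D r) ≫ m f)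

/-- The decomposition of the identity of N through copies of N' is carried by naturality to both
sides of the pairing. It serves to pass from A to the finite free modules. -/
theorem extPairing_bijective_of_retract {N N' : Type u} [AddCommGroup N] [Module A N]
    [AddCommGroup N'] [Module A N'] {ι : Type*} [Fintype ι] (p : ι → (N →ₗ[A] N'))
    (j : ι → (N' →ₗ[A] N)) (h : ∑ i, j i ∘ₗ p i = LinearMap.id) (q : ℕ)
    (hN' : Function.Bijective (extPairing L m hm N' q)) :
    Function.Bijective (extPairing L m hm N q) := by
  let P : ι → (ModuleCat.of A N ⟶ ModuleCat.of A N') := fun i => ModuleCat.ofHom (p i)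
  let J : ι → (ModuleCat.of A N' ⟶ ModuleCat.of A N) := fun i => ModuleCat.ofHom (j i)
  have hPJ : ∑ i, P i ≫ J i = 𝟙 _ := by
    ext x
    simpa [P, J] using LinearMap.congr_fun h x
  have hLPJ : ∑ i, L.map (P i) ≫ L.map (J i) = 𝟙 _ := by
    rw [← L.map_id, ← hPJ, L.map_sum]
    exact Finset.sum_congr rfl fun i _ => (L.map_comp _ _).symm
  have hc : ∀ e : ExtGp A N D q, ∑ i, extPrecomp R (Ext.mk₀ (P i)) (zero_add q)
      (extPrecomp R (Ext.mk₀ (J i)) (zero_add q) e) = e := by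
    intro e
    have : ∀ i, extPrecomp R (Ext.mk₀ (P i)) (zero_add q)
        (extPrecomp R (Ext.mk₀ (J i)) (zero_add q) e) =
        (Ext.mk₀ (P i ≫ J i)).comp e (zero_add q) := fun i => Ext.mk₀_comp_mk₀_assoc _ _ _
    rw [Finset.sum_congr rfl fun i _ => this i, ← Ext.sum_comp, ← Ext.mk₀_sum, hPJ,
      Ext.mk₀_id_comp]
  have hG : ∀ t : NCTensor R F (ExtGp A N D q),
      ∑ i, NCTensor.map LinearMap.id (extPrecomp R (Ext.mk₀ (P i)) (zero_add q))
        (NCTensor.map LinearMap.id (extPrecomp R (Ext.mk₀ (J i)) (zero_add q)) t) = t := by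
    intro t
    induction t using NCTensor.induction_on with
    | h0 => simp
    | ht f e =>
      simp only [NCTensor.map_tmul, LinearMap.id_apply]
      conv_rhs => rw [← hc e]
      exact (map_sum (AddMonoidHom.mk' (fun e => NCTensor.tmul R f e) (NCTensor.tmul_add f))
        _ _).symm
    | ha x y hx hy =>
      simp only [map_add, Finset.sum_add_distrib]
      rw [hx, hy]
  have hH : ∀ y : Ext (L.obj (ModuleCat.of A N)) (ModuleCat.of A' D') q,
      ∑ i, (Ext.mk₀ (L.map (P i))).comp ((Ext.mk₀ (L.map (J i))).comp y (zero_add q))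
        (zero_add q) = y := by
    intro y
    simp only [Ext.mk₀_comp_mk₀_assoc]
    rw [← Ext.sum_comp, ← Ext.mk₀_sum, hLPJ, Ext.mk₀_id_comp]
  constructor
  · rw [injective_iff_map_eq_zero]
    intro t ht
    rw [← hG t]
    refine Finset.sum_eq_zero fun i _ => ?_
    have : NCTensor.map LinearMap.id (extPrecomp R (Ext.mk₀ (J i)) (zero_add q)) t = 0 := by
      refine (injective_iff_map_eq_zero _).1 hN'.1 _ ?_
      rw [extPairing_precomp, ht, Ext.comp_zero]
    rw [this, map_zero]
  · intro y
    choose x hx using fun i => hN'.2 ((Ext.mk₀ (L.map (J i))).comp y (zero_add q))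
    refine ⟨∑ i, NCTensor.map LinearMap.id (extPrecomp R (Ext.mk₀ (P i)) (zero_add q)) (x i), ?_⟩
    rw [map_sum]
    conv_rhs => rw [← hH y]
    refine Finset.sum_congr rfl fun i _ => ?_
    rw [extPairing_precomp, hx, Ext.mapExactFunctor_mk₀]

theorem subsingleton_ext_of_projective {C : ModuleCat.{u} A} (hC : Projective C)
    (Y : ModuleCat.{u} A) (q : ℕ) : Subsingleton (Ext C Y (q + 1)) :=
  ⟨fun a b => by rw [Ext.eq_zero_of_projective a, Ext.eq_zero_of_projective b]⟩

theorem NCTensor.subsingleton {M N : Type u} [AddCommGroup M] [Module Rᵐᵒᵖ M] [AddCommGroup N]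
    [Module R N] [Subsingleton N] : Subsingleton (NCTensor R M N) := by
  refine subsingleton_of_forall_eq 0 fun t => ?_
  induction t using NCTensor.induction_on with
  | h0 => rfl
  | ht m n => rw [Subsingleton.elim n 0, NCTensor.tmul_zero]
  | ha x y hx hy => rw [hx, hy, add_zero]

theorem NCTensor.subsingleton_left {M N : Type u} [AddCommGroup M] [Module Rᵐᵒᵖ M]
    [AddCommGroup N] [Module R N] [Subsingleton M] : Subsingleton (NCTensor R M N) := by
  refine subsingleton_of_forall_eq 0 fun t => ?_
  induction t using NCTensor.induction_on with
  | h0 => rfl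
  | ht m n => rw [Subsingleton.elim m 0, NCTensor.zero_tmul]
  | ha x y hx hy => rw [hx, hy, add_zero]

theorem extPairing_free_bijective (u : L.obj (ModuleCat.of A A))
    (hu : Function.Bijective (LinearMap.toSpanSingleton A' (L.obj (ModuleCat.of A A)) u))
    (β : NCTensor R F D →+ D') (hβ : Function.Bijective β)
    (hβm : ∀ f d, β (NCTensor.tmul R f d) =
      (m f).hom ((L.map (ModuleCat.ofHom (LinearMap.toSpanSingleton A D d))).hom u))
    (n q : ℕ) : Function.Bijective (extPairing L m hm (Fin n → A) q) := by
  refine extPairing_bijective_of_retract L m hm (N' := A) (fun i => LinearMap.proj i)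
    (fun i => LinearMap.single A (fun _ => A) i)
    (by ext i x; simp [Pi.single_apply]) q ?_
  cases q with
  | zero => exact extPairing_base_bijective L m hm u hu β hβ hβm
  | succ q =>
    -- In positive degree both sides vanish: A is projective, and so is its image under `L`, being
    -- free on `u`.
    have h1 : Projective (ModuleCat.of A A) := (IsProjective.iff_projective A).1 inferInstance
    have h2 : Projective (L.obj (ModuleCat.of A A)) := by
      have := Module.Projective.of_equiv (LinearEquiv.ofBijective _ hu)
      exact (IsProjective.iff_projective _).1 this
    have := subsingleton_ext_of_projective h1 (ModuleCat.of A D) q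
    have := subsingleton_ext_of_projective h2 (ModuleCat.of A' D') q
    have := NCTensor.subsingleton (R := R) (M := F) (N := ExtGp A A D (q + 1))
    exact ⟨Function.injective_of_subsingleton _, fun y => ⟨0, Subsingleton.elim _ _⟩⟩

/-- `F ⊗_R Ext_A(N, D) ≅ Ext_{A'}(L N, D')` for finitely generated `N` and flat `F`. -/
theorem extPairing_bijective [IsNoetherianRing A] (hF : IsFlatRight R F)
    (u : L.obj (ModuleCat.of A A))
    (hu : Function.Bijective (LinearMap.toSpanSingleton A' (L.obj (ModuleCat.of A A)) u))
    (β : NCTensor R F D →+ D') (hβ : Function.Bijective β)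
    (hβm : ∀ f d, β (NCTensor.tmul R f d) =
      (m f).hom ((L.map (ModuleCat.ofHom (LinearMap.toSpanSingleton A D d))).hom u))
    (q : ℕ) (N : Type u) [AddCommGroup N] [Module A N] [Module.Finite A N] :
    Function.Bijective (extPairing L m hm N q) := by
  induction q generalizing N with
  | zero =>
    -- Injectivity is needed for all finitely generated modules beforehand: the left exact
    -- comparison below uses it for the kernel of a free cover, which is finitely generated because
    -- A is noetherian.
    have hinj : ∀ (N : Type u) [AddCommGroup N] [Module A N] [Module.Finite A N],
        Function.Injective (extPairing L m hm N 0) := by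
      intro N _ _ _
      obtain ⟨n, f, hf⟩ := Module.Finite.exists_fin' A N
      have hS := LinearMap.shortExact_shortComplexKer hf
      have := hS.epi_g
      have h1 : Function.Injective (extPrecomp (N := Fin n → A) (N' := N) (D := D) R
          (Ext.mk₀ (ModuleCat.ofHom f)) (zero_add 0)) :=
        Ext.precomp_mk₀_injective_of_epi (ModuleCat.of A D) (ModuleCat.ofHom f)
      have h2 := (extPairing_free_bijective L m hm u hu β hβ hβm n 0).1.comp (hF _ _ _ h1)
      refine Function.Injective.of_comp (f := fun y =>
        ((Ext.mk₀ (ModuleCat.ofHom f)).mapExactFunctor L).comp y (zero_add 0)) ?_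
      convert h2 using 1
      funext t
      exact (extPairing_precomp L m hm _ _ t).symm
    obtain ⟨n, f, hf⟩ := Module.Finite.exists_fin' A N
    have hS := LinearMap.shortExact_shortComplexKer hf
    have hLS := hS.map_of_exact L
    have := hS.epi_g
    have := hLS.epi_g
    refine AddMonoidHom.bijective_of_bijective_of_injective_of_left_exact
      (NCTensor.map LinearMap.id (extPrecomp (D := D) R
        (Ext.mk₀ (f.shortComplexKer.g)) (zero_add 0)))
      (NCTensor.map LinearMap.id (extPrecomp (D := D) R
        (Ext.mk₀ (f.shortComplexKer.f)) (zero_add 0)))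
      ((Ext.mk₀ (L.map f.shortComplexKer.g)).precomp (ModuleCat.of A' D') (zero_add 0))
      ((Ext.mk₀ (L.map f.shortComplexKer.f)).precomp (ModuleCat.of A' D') (zero_add 0))
      (extPairing L m hm N 0) (extPairing L m hm (Fin n → A) 0)
      (extPairing L m hm (LinearMap.ker f) 0) ?_ ?_ ?_ ?_ ?_ ?_ ?_ ?_
    · ext t
      exact (Ext.mapExactFunctor_mk₀ L f.shortComplexKer.g ▸ extPairing_precomp L m hm _ _ t).symm
    · ext t
      exact (Ext.mapExactFunctor_mk₀ L f.shortComplexKer.f ▸ extPairing_precomp L m hm _ _ t).symm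
    · exact hF.exact _ _ ((ShortComplex.ab_exact_iff_function_exact _).1
        (Ext.contravariant_sequence_exact₂' hS (ModuleCat.of A D) 0))
    · exact (ShortComplex.ab_exact_iff_function_exact _).1
        (Ext.contravariant_sequence_exact₂' hLS (ModuleCat.of A' D') 0)
    · exact extPairing_free_bijective L m hm u hu β hβ hβm n 0
    · exact hinj _
    · exact hF _ _ _ (Ext.precomp_mk₀_injective_of_epi (ModuleCat.of A D) f.shortComplexKer.g)
    · exact Ext.precomp_mk₀_injective_of_epi (ModuleCat.of A' D') (L.map f.shortComplexKer.g)
  | succ q ih =>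
    obtain ⟨n, f, hf⟩ := Module.Finite.exists_fin' A N
    have hS := LinearMap.shortExact_shortComplexKer hf
    have hLS := hS.map_of_exact L
    have hPG := extPairing_free_bijective L m hm u hu β hβ hβm n (q + 1)
    have h1 : Projective (ModuleCat.of A (Fin n → A)) :=
      (IsProjective.iff_projective _).1 inferInstance
    have hsub := subsingleton_ext_of_projective h1 (ModuleCat.of A D) q
    -- The pairing for the free module is onto and its source is zero, so the target is zero too.
    have hsub' : Subsingleton (Ext (L.obj (ModuleCat.of A (Fin n → A)))
        (ModuleCat.of A' D') (q + 1)) := by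
      have := NCTensor.subsingleton (R := R) (M := F) (N := ExtGp A (Fin n → A) D (q + 1))
      exact hPG.2.subsingleton
    -- Dimension shifting: Ext^(q+1) of N is the cokernel of the map from Ext^q of the free cover to
    -- Ext^q of its kernel, on both sides.
    refine AddMonoidHom.bijective_of_surjective_of_bijective_of_right_exact
      (NCTensor.map LinearMap.id (extPrecomp (D := D) R
        (Ext.mk₀ (f.shortComplexKer.f)) (zero_add q)))
      (NCTensor.map LinearMap.id (extPrecomp (D := D) R hS.extClass (add_comm 1 q)))
      ((Ext.mk₀ (L.map f.shortComplexKer.f)).precomp (ModuleCat.of A' D') (zero_add q))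
      (hLS.extClass.precomp (ModuleCat.of A' D') (add_comm 1 q))
      (extPairing L m hm (Fin n → A) q) (extPairing L m hm (LinearMap.ker f) q)
      (extPairing L m hm N (q + 1)) ?_ ?_ ?_ ?_ ?_ ?_ ?_ ?_
    · ext t
      exact (Ext.mapExactFunctor_mk₀ L f.shortComplexKer.f ▸ extPairing_precomp L m hm _ _ t).symm
    · ext t
      exact (Ext.mapExactFunctor_extClass L hS ▸ extPairing_precomp L m hm _ _ t).symm
    · exact hF.exact _ _ ((ShortComplex.ab_exact_iff_function_exact _).1
        (Ext.contravariant_sequence_exact₁' hS (ModuleCat.of A D) q (q + 1) (add_comm 1 q)))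
    · exact (ShortComplex.ab_exact_iff_function_exact _).1
        (Ext.contravariant_sequence_exact₁' hLS (ModuleCat.of A' D') q (q + 1) (add_comm 1 q))
    · exact (extPairing_free_bijective L m hm u hu β hβ hβm n q).2
    · exact ih _
    · refine NCTensor.map_surjective _ fun e => ?_
      exact Ext.contravariant_sequence_exact₃ hS (ModuleCat.of A D) e (hsub.elim _ _)
        (add_comm 1 q)
    · intro e
      exact Ext.contravariant_sequence_exact₃ hLS (ModuleCat.of A' D') e (hsub'.elim _ _)
        (add_comm 1 q)

end Pairing

/-! ### Ext under the identity functor -/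

section Identity

open Abelian Limits

/-- The identity functor acts as the identity on Ext. -/
theorem mapExactFunctor_id {A : Type u} [Ring A] {N D : ModuleCat.{u} A} {q : ℕ}
    (e : Ext N D q) : e.mapExactFunctor (𝟭 _) = e := by
  induction q generalizing N with
  | zero =>
    obtain ⟨g, rfl⟩ := (Ext.mk₀_bijective _ _).2 e
    rw [Ext.mapExactFunctor_mk₀]
    rfl
  | succ q ih =>
    -- A class of positive degree is the class of a projective presentation times a class of one
    -- degree less.
    have hS := ModuleCat.shortExact_projectiveShortComplex N
    have h0 : (Ext.mk₀ (N.projectiveShortComplex.g)).comp e (zero_add _) = 0 :=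
      Ext.eq_zero_of_projective _
    obtain ⟨e', rfl⟩ := Ext.contravariant_sequence_exact₃ hS D e h0 (add_comm 1 q)
    rw [Ext.mapExactFunctor_comp, Ext.mapExactFunctor_extClass]
    exact congrArg (hS.extClass.comp · _) (ih e')

end Identity

/-! ### The extended ideal P_X and the factor ring R_X/P_X -/

section Quo

variable {R : Type u} [Ring R]

theorem Quo.mk_surjective (I : TwoSidedIdeal R) : Function.Surjective (Quo.mk I) :=
  I.ringCon.mk'_surjective

theorem Quo.mk_eq_zero {I : TwoSidedIdeal R} {r : R} : Quo.mk I r = 0 ↔ r ∈ I := by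
  rw [TwoSidedIdeal.mem_iff]
  exact I.ringCon.eq

variable [IsNoetherianRing R] {X : Submonoid R} [IsOreSet X] {P : TwoSidedIdeal R}

namespace Loc

theorem of_mem_ext {p : R} (hp : p ∈ P) : of X p ∈ ext X P :=
  TwoSidedIdeal.subset_span ⟨p, hp, rfl⟩

/-- The left fractions with numerator in P already form a two-sided ideal, which therefore contains
P_X. -/
theorem exists_mul_eq_of_mem_ext (hX : X ≤ regularMod P) {z : Loc X} (hz : z ∈ ext X P) :
    ∃ s ∈ X, ∃ p ∈ P, of X s * z = of X p := by
  let K : TwoSidedIdeal (Loc X) := TwoSidedIdeal.mk' {z | ∃ s ∈ X, ∃ p ∈ P, of X s * z = of X p}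
    ⟨1, X.one_mem, 0, P.zero_mem, by simp⟩
    (by
      rintro x y ⟨s, hs, p, hp, h⟩ ⟨s', hs', p', hp', h'⟩
      obtain ⟨a, b, hb, e⟩ := IsOreSet.left_ore (X := X) s s' hs'
      refine ⟨b * s, X.mul_mem hb hs, b * p + a * p',
        P.add_mem (P.mul_mem_left _ _ hp) (P.mul_mem_left _ _ hp'), ?_⟩
      have h1 : of X (b * s) * y = of X (a * p') := by rw [e, map_mul, mul_assoc, h', map_mul]
      rw [mul_add, h1, map_mul, mul_assoc, h, ← map_mul, ← map_add])
    (by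
      rintro x ⟨s, hs, p, hp, h⟩
      exact ⟨s, hs, -p, P.neg_mem hp, by rw [mul_neg, h, map_neg]⟩)
    (by
      rintro y z ⟨s, hs, p, hp, h⟩
      obtain ⟨r, t, ht, e⟩ := exists_of_mul_eq y
      obtain ⟨r', s', hs', e'⟩ := IsOreSet.left_ore (X := X) r s hs
      refine ⟨s' * t, X.mul_mem hs' ht, r' * p, P.mul_mem_left _ _ hp, ?_⟩
      rw [← mul_assoc, map_mul, mul_assoc (of X s'), e, ← map_mul, e', map_mul, mul_assoc, h,
        map_mul])
    (by
      rintro z y ⟨s, hs, p, hp, h⟩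
      obtain ⟨r, t, ht, e⟩ := exists_of_mul_eq y
      obtain ⟨p', t', ht', e'⟩ := IsOreSet.left_ore (X := X) p t ht
      -- Closure under right multiplication is where regularity modulo P enters: t' p = p' t lies in
      -- P, hence so does p'.
      have hp' : p' ∈ P := (hX ht p').2 (e' ▸ P.mul_mem_left _ _ hp)
      refine ⟨t' * s, X.mul_mem ht' hs, p' * r, P.mul_mem_right _ _ hp', ?_⟩
      rw [← mul_assoc, map_mul, mul_assoc (of X t'), h, ← map_mul, e', map_mul, mul_assoc, e,
        map_mul])
  have hK : ext X P ≤ K := TwoSidedIdeal.span_le.2 (by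
    rintro _ ⟨p, hp, rfl⟩
    exact (TwoSidedIdeal.mem_mk' ..).2 ⟨1, X.one_mem, p, hp, by simp⟩)
  have h1 : z ∈ K := hK hz
  rwa [TwoSidedIdeal.mem_mk'] at h1

theorem exists_eq_mul_of_mem_ext (hX : X ≤ regularMod P) {z : Loc X} (hz : z ∈ ext X P) :
    ∃ p ∈ P, ∃ y : Loc X, z = of X p * y := by
  obtain ⟨s, hs, p, hp, h⟩ := exists_mul_eq_of_mem_ext hX hz
  obtain ⟨p', s', hs', e⟩ := IsOreSet.right_ore (X := X) p s hs
  have hp' : p' ∈ P := (hX hs p').1 (e ▸ P.mul_mem_right _ _ hp)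
  obtain ⟨u, hu⟩ := isUnit_of hs'
  refine ⟨p', hp', ↑u⁻¹, ?_⟩
  rw [Units.eq_mul_inv_iff_mul_eq, hu]
  refine (isUnit_of hs).mul_left_cancel ?_
  rw [← mul_assoc, h, ← map_mul, ← map_mul, e]

theorem of_mem_ext_iff (hX : X ≤ regularMod P) {r : R} : of X r ∈ ext X P ↔ r ∈ P := by
  refine ⟨fun h => ?_, of_mem_ext⟩
  obtain ⟨s, hs, p, hp, h⟩ := exists_mul_eq_of_mem_ext hX h
  rw [← map_mul, ← sub_eq_zero, ← map_sub] at h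
  obtain ⟨s', hs', h⟩ := of_eq_zero h
  refine (hX hs r).1 ((hX hs' _).1 ?_)
  rw [mul_sub, sub_eq_zero] at h
  rw [h]
  exact P.mul_mem_left _ _ hp

/-- Elements regular modulo `P` become invertible in the artinian ring `R_X / P_X`. -/
theorem exists_mul_sub_one_mem_ext (hX : X ≤ regularMod P) [IsArtinianRing (Quo (ext X P))]
    {c : R} (hc : c ∈ regularMod P) : ∃ y : Loc X, of X c * y - 1 ∈ ext X P := by
  -- An injective endomorphism of an artinian module is onto; applied to right multiplication by c,
  -- this gives a left inverse.
  have hinj : ∀ c : Quo (ext X P), (∀ x, x * c = 0 → x = 0) → ∃ y, y * c = 1 := fun c h => by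
    have h1 : Function.Injective (LinearMap.toSpanSingleton (Quo (ext X P)) _ c) :=
      (injective_iff_map_eq_zero _).2 h
    exact IsArtinian.surjective_of_injective_endomorphism _ h1 1
  obtain ⟨y, hy⟩ := hinj (Quo.mk _ (of X c)) fun x hx => by
    obtain ⟨x, rfl⟩ := Quo.mk_surjective _ x
    rw [← map_mul, Quo.mk_eq_zero] at hx
    rw [Quo.mk_eq_zero]
    obtain ⟨r, s, hs, e⟩ := exists_of_mul_eq x
    have h1 := TwoSidedIdeal.mul_mem_left _ (of X s) _ hx
    rw [← mul_assoc, e, ← map_mul, of_mem_ext_iff hX] at h1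
    have h2 := of_mem_ext (X := X) ((hc r).2 h1)
    rw [← e] at h2
    obtain ⟨u, hu⟩ := isUnit_of hs
    have h3 := TwoSidedIdeal.mul_mem_left _ (↑u⁻¹ : Loc X) _ h2
    rwa [← hu, Units.inv_mul_cancel_left] at h3
  -- The left inverse y of c has a left inverse itself, which must equal c; hence y is also a right
  -- inverse.
  obtain ⟨z, hz⟩ := hinj y fun x hx => by rw [← mul_one x, ← hy, ← mul_assoc, hx, zero_mul]
  have hzc : z = Quo.mk _ (of X c) := by rw [← mul_one z, ← hy, ← mul_assoc, hz, one_mul]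
  obtain ⟨y, rfl⟩ := Quo.mk_surjective _ y
  refine ⟨y, ?_⟩
  rw [← Quo.mk_eq_zero, map_sub, map_mul, ← hzc, hz, map_one, sub_self]

end Loc

/-- The ring homomorphism `R/P → R_X/P_X`. -/
def Quo.toLoc (X : Submonoid R) [IsOreSet X] (P : TwoSidedIdeal R) :
    Quo P →+* Quo (Loc.ext X P) :=
  P.ringCon.lift ((Quo.mk (Loc.ext X P)).comp (Loc.of X)) fun a b h => by
    have : a - b ∈ P := (TwoSidedIdeal.rel_iff _ _ _).1 h
    change Quo.mk _ (Loc.of X a) = Quo.mk _ (Loc.of X b)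
    rw [← sub_eq_zero, ← map_sub, ← map_sub, Quo.mk_eq_zero]
    exact Loc.of_mem_ext this

theorem Quo.toLoc_mk (r : R) : Quo.toLoc X P (Quo.mk P r) = Quo.mk _ (Loc.of X r) := rfl

variable (X P) in
/-- The map `R/P ⊗ R_X → R_X/P_X`, as a map of abelian groups. -/
def tensorQuoAddHom : NCTensor R (Quo P) (Loc X) →+ Quo (Loc.ext X P) :=
  NCTensor.lift
    (AddMonoidHom.mk' (fun a => AddMonoidHom.mk' (fun x => Quo.toLoc X P a * Quo.mk _ x)
      fun x y => by rw [map_add, mul_add])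
      fun a b => by ext x; simp [add_mul])
    (fun a r x => by
      change Quo.toLoc X P (a * Quo.mk P r) * Quo.mk _ x =
        Quo.toLoc X P a * Quo.mk _ (Loc.of X r * x)
      rw [map_mul, map_mul, Quo.toLoc_mk, mul_assoc])

variable (X P) in
/-- The map `R/P ⊗ R_X → R_X/P_X`. -/
def tensorQuoHom : NCTensor R (Quo P) (Loc X) →ₗ[(Loc X)ᵐᵒᵖ] Quo (Loc.ext X P) where
  toFun := tensorQuoAddHom X P
  map_add' := map_add _
  map_smul' y := DFunLike.congr_fun
    (f := (tensorQuoAddHom X P).comp (DistribSMul.toAddMonoidHom _ y))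
    (g := (DistribSMul.toAddMonoidHom _ y).comp (tensorQuoAddHom X P))
    (NCTensor.hom_ext fun a x => by
      change Quo.toLoc X P a * Quo.mk _ (x * y.unop) =
        (Quo.toLoc X P a * Quo.mk _ x) * Quo.mk _ y.unop
      rw [map_mul, mul_assoc])

theorem tensorQuoHom_tmul (a : Quo P) (x : Loc X) :
    tensorQuoHom X P (NCTensor.tmul R a x) = Quo.toLoc X P a * Quo.mk _ x := rfl

/-- For injectivity, clear the denominator and use that P_X contracts to P. -/
theorem tensorQuoHom_bijective (hX : X ≤ regularMod P) :
    Function.Bijective (tensorQuoHom X P) := by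
  refine ⟨(injective_iff_map_eq_zero _).2 fun t ht => ?_, fun z => ?_⟩
  · obtain ⟨m, s, hs, e⟩ := NCTensor.exists_smul_eq_tmul_one t
    have h1 := congrArg (tensorQuoHom X P) e
    rw [map_smul, ht, smul_zero, tensorQuoHom_tmul, map_one, mul_one] at h1
    obtain ⟨r, rfl⟩ := Quo.mk_surjective P m
    rw [Quo.toLoc_mk, eq_comm, Quo.mk_eq_zero, Loc.of_mem_ext_iff hX, ← Quo.mk_eq_zero] at h1
    rw [h1, NCTensor.zero_tmul] at e
    exact NCTensor.eq_zero_of_smul_op hs e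
  · obtain ⟨z, rfl⟩ := Quo.mk_surjective _ z
    exact ⟨NCTensor.tmul R 1 z, by rw [tensorQuoHom_tmul, map_one, one_mul]⟩

/-- `R_X/P_X ≅ R/P ⊗ R_X`. -/
def quoEquivTensor (hX : X ≤ regularMod P) :
    Quo (Loc.ext X P) ≃ₗ[(Loc X)ᵐᵒᵖ] NCTensor R (Quo P) (Loc X) :=
  (LinearEquiv.ofBijective _ (tensorQuoHom_bijective hX)).symm

theorem quoEquivTensor_smul (hX : X ≤ regularMod P) (r : R) (z : Quo (Loc.ext X P)) :
    quoEquivTensor hX (Loc.of X r • z) = r • quoEquivTensor hX z := by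
  obtain ⟨t, rfl⟩ := (tensorQuoHom_bijective hX).2 z
  have h1 : ∀ t, quoEquivTensor hX (tensorQuoHom X P t) = t :=
    (LinearEquiv.ofBijective _ (tensorQuoHom_bijective hX)).symm_apply_apply
  have h2 : Loc.of X r • tensorQuoHom X P t = tensorQuoHom X P (r • t) := DFunLike.congr_fun
    (f := (DistribSMul.toAddMonoidHom _ (Loc.of X r)).comp (tensorQuoAddHom X P))
    (g := (tensorQuoAddHom X P).comp (DistribSMul.toAddMonoidHom _ r))
    (NCTensor.hom_ext fun a x => by
      change Quo.mk _ (Loc.of X r) * (Quo.toLoc X P a * Quo.mk _ x) =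
        Quo.toLoc X P (Quo.mk P r * a) * Quo.mk _ x
      rw [map_mul, Quo.toLoc_mk, mul_assoc]) t
  rw [h2, h1, h1]

end Quo

/-! ### The natural comparison maps on Ext -/

section

open Abelian

section Units

variable {R : Type u} [Ring R] {N M : Type u} [AddCommGroup N] [Module R N]
  [AddCommGroup M] [Module Rᵐᵒᵖ M]

variable (R N) in
/-- `R ⊗ N → N`. -/
def NCTensor.lid : NCTensor R R N →+ N :=
  NCTensor.lift
    (AddMonoidHom.mk' (fun r : R => AddMonoidHom.mk' (fun n : N => r • n) (smul_add r))
      fun r s => by ext n; exact add_smul r s n)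
    (fun r s n => mul_smul r s n)

theorem NCTensor.lid_bijective : Function.Bijective (NCTensor.lid R N) := by
  have h : ∀ t, NCTensor.tmul R (1 : R) (NCTensor.lid R N t) = t := DFunLike.congr_fun
    (f := (AddMonoidHom.mk' (NCTensor.tmul R (1 : R)) (NCTensor.tmul_add 1)).comp
      (NCTensor.lid R N)) (g := AddMonoidHom.id _) (NCTensor.hom_ext fun r n => by
        change NCTensor.tmul R (1 : R) (r • n) = NCTensor.tmul R r n
        rw [← NCTensor.smul_tmul]
        exact congrArg (NCTensor.tmul R · n) (one_mul r))
  exact ⟨Function.LeftInverse.injective h, fun n => ⟨NCTensor.tmul R 1 n, one_smul R n⟩⟩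

variable (R M) in
/-- `M ⊗ R → M`. -/
def NCTensor.rid : NCTensor R M R →+ M :=
  NCTensor.lift
    (AddMonoidHom.mk' (fun m : M => AddMonoidHom.mk' (fun r : R => MulOpposite.op r • m)
      fun r s => add_smul (MulOpposite.op r) (MulOpposite.op s) m)
      fun m m' => by ext r; exact smul_add _ m m')
    (fun m r s => (mul_smul (MulOpposite.op s) (MulOpposite.op r) m).symm)

theorem NCTensor.rid_bijective : Function.Bijective (NCTensor.rid R M) := by
  have h : ∀ t, NCTensor.tmul R (NCTensor.rid R M t) (1 : R) = t := DFunLike.congr_fun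
    (f := (AddMonoidHom.mk' (fun m => NCTensor.tmul R m (1 : R))
      (fun m m' => NCTensor.add_tmul m m' 1)).comp
      (NCTensor.rid R M)) (g := AddMonoidHom.id _) (NCTensor.hom_ext fun m r => by
        change NCTensor.tmul R (MulOpposite.op r • m) (1 : R) = NCTensor.tmul R m r
        rw [NCTensor.smul_tmul]
        exact congrArg _ (mul_one r))
  exact ⟨Function.LeftInverse.injective (g := fun m => NCTensor.tmul R m (1 : R)) h,
    fun m => ⟨NCTensor.tmul R m 1, one_smul Rᵐᵒᵖ m⟩⟩

end Units

variable {R : Type u} [Ring R] [IsNoetherianRing R]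
  {X : Submonoid R} [IsOreSet X] {P : TwoSidedIdeal R} (hX : X ≤ regularMod P)

instance : SMulCommClass (Loc X)ᵐᵒᵖ R (Loc X) := SMulCommClass.symm _ _ _

/-- `R_X/P_X → R/P ⊗ R_X` as a morphism of right `R_X`-modules. -/
def quoHom : ModuleCat.of (Loc X)ᵐᵒᵖ (Quo (Loc.ext X P)) ⟶
    (locFunctor X).obj (ModuleCat.of Rᵐᵒᵖ (Quo P)) :=
  ModuleCat.ofHom (quoEquivTensor hX).toLinearMap

instance : IsIso (quoHom hX) := (quoEquivTensor hX).toModuleIso.isIso_hom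

theorem actHom_quoHom (r : R) : actHom (Loc X)ᵐᵒᵖ (Quo (Loc.ext X P)) (Loc.of X r) ≫ quoHom hX =
    quoHom hX ≫ (locFunctor X).map (actHom Rᵐᵒᵖ (Quo P) r) :=
  ModuleCat.hom_ext <| LinearMap.ext fun z => quoEquivTensor_smul hX r z

variable (X) in
/-- The isomorphism `R ⊗ R_X → R_X` of right `R_X`-modules. -/
def lidHom : (locFunctor X).obj (ModuleCat.of Rᵐᵒᵖ R) ⟶ ModuleCat.of (Loc X)ᵐᵒᵖ (Loc X) :=
  ModuleCat.ofHom
    { toFun := NCTensor.lid R (Loc X)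
      map_add' := map_add _
      map_smul' := fun y => DFunLike.congr_fun
        (f := (NCTensor.lid R (Loc X)).comp (DistribSMul.toAddMonoidHom _ y))
        (g := (DistribSMul.toAddMonoidHom _ y).comp (NCTensor.lid R (Loc X)))
        (NCTensor.hom_ext fun r x => (mul_assoc (Loc.of X r) x y.unop).symm) }

instance : IsIso (lidHom X) := by
  rw [ConcreteCategory.isIso_iff_bijective]
  exact NCTensor.lid_bijective

theorem map_actHom_lidHom (r : R) : (locFunctor X).map (actHom Rᵐᵒᵖ R r) ≫ lidHom X =
    lidHom X ≫ actHom (Loc X)ᵐᵒᵖ (Loc X) (Loc.of X r) :=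
  ModuleCat.hom_ext <| LinearMap.ext <| DFunLike.congr_fun
    (f := (NCTensor.lid R (Loc X)).comp (NCTensor.map (NCTensor.lact Rᵐᵒᵖ r) LinearMap.id))
    (g := (DistribSMul.toAddMonoidHom _ (Loc.of X r)).comp (NCTensor.lid R (Loc X)))
    (NCTensor.hom_ext fun s x => by
      change Loc.of X (r * s) * x = Loc.of X r * (Loc.of X s * x)
      rw [map_mul, mul_assoc])

/-- The action of `R_X` on `R_X`, as homomorphisms `R ⊗ R_X → R_X`. -/
def actLidHom : Loc X →+
    ((locFunctor X).obj (ModuleCat.of Rᵐᵒᵖ R) ⟶ ModuleCat.of (Loc X)ᵐᵒᵖ (Loc X)) :=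
  AddMonoidHom.mk' (fun x => lidHom X ≫ actHom (Loc X)ᵐᵒᵖ (Loc X) x)
    fun x y => by rw [actHom_add, Preadditive.comp_add]

/-- The balance condition that lets R_X serve as the module F in `extPairing`. -/
theorem actLidHom_smul (x : Loc X) (r : R) : actLidHom (MulOpposite.op r • x) =
    (locFunctor X).map (actHom Rᵐᵒᵖ R r) ≫ actLidHom x := by
  change lidHom X ≫ actHom (Loc X)ᵐᵒᵖ (Loc X) (x * Loc.of X r) =
    (locFunctor X).map (actHom Rᵐᵒᵖ R r) ≫ lidHom X ≫ actHom (Loc X)ᵐᵒᵖ (Loc X) x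
  rw [actHom_mul, ← Category.assoc, ← map_actHom_lidHom, Category.assoc]

variable (X) in
-- Supplies the free generator 1 ⊗ 1 that `extPairing_bijective` requires of the localization
-- functor.
theorem toSpanSingleton_loc_bijective :
    Function.Bijective (LinearMap.toSpanSingleton (Loc X)ᵐᵒᵖ
      ((locFunctor X).obj (ModuleCat.of Rᵐᵒᵖ Rᵐᵒᵖ)) (NCTensor.tmul R (1 : Rᵐᵒᵖ) (1 : Loc X))) := by
  let g : NCTensor R Rᵐᵒᵖ (Loc X) →+ Loc X := NCTensor.lift
    (AddMonoidHom.mk' (fun a => AddMonoidHom.mk' (fun x => Loc.of X a.unop * x)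
      fun x y => mul_add _ x y) fun a b => by
        ext x
        change Loc.of X (a.unop + b.unop) * x = Loc.of X a.unop * x + Loc.of X b.unop * x
        rw [map_add, add_mul])
    fun a r x => by
      change Loc.of X (a.unop * r) * x = Loc.of X a.unop * (Loc.of X r * x)
      rw [map_mul, mul_assoc]
  constructor
  · refine Function.LeftInverse.injective (g := fun t => MulOpposite.op (g t)) fun y => ?_
    refine MulOpposite.unop_injective ?_
    change Loc.of X 1 * (1 * y.unop) = y.unop
    rw [map_one, one_mul, one_mul]
  · have h : ∀ t, NCTensor.tmul R (1 : Rᵐᵒᵖ) (g t) = t := DFunLike.congr_fun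
      (f := (AddMonoidHom.mk' (NCTensor.tmul R (1 : Rᵐᵒᵖ)) (NCTensor.tmul_add 1)).comp g)
      (g := AddMonoidHom.id _) (NCTensor.hom_ext fun a x => by
        change NCTensor.tmul R (1 : Rᵐᵒᵖ) (a.unop • x) = NCTensor.tmul R a x
        rw [← NCTensor.smul_tmul]
        exact congrArg (NCTensor.tmul R · x) (mul_one a))
    intro t
    refine ⟨MulOpposite.op (g t), ?_⟩
    change NCTensor.tmul R (1 : Rᵐᵒᵖ) (1 * g t) = t
    rw [one_mul]
    exact h t

variable [IsNoetherianRing Rᵐᵒᵖ]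

section Comparison

variable (M : Type u) [AddCommGroup M] [Module Rᵐᵒᵖ M] (i : ℕ)

/-- The natural map `Ext_R(R/P, M) → Ext_{R_X}(R_X/P_X, M ⊗ R_X)`. -/
def locExt : ExtGp Rᵐᵒᵖ (Quo P) M i →+
    ExtGp (Loc X)ᵐᵒᵖ (Quo (Loc.ext X P)) (NCTensor R M (Loc X)) i :=
  AddMonoidHom.mk' (fun e => (Ext.mk₀ (quoHom hX)).comp (e.mapExactFunctor (locFunctor X))
    (zero_add i)) fun e e' => by rw [Ext.mapExactFunctor_add, Ext.comp_add]; rfl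

theorem locExt_smul (r : R) (e : ExtGp Rᵐᵒᵖ (Quo P) M i) :
    locExt hX M i (MulOpposite.op r • e) = MulOpposite.op (Loc.of X r) • locExt hX M i e := by
  change (Ext.mk₀ (quoHom hX)).comp (((Ext.mk₀ (actHom Rᵐᵒᵖ (Quo P) r)).comp e
      (zero_add i)).mapExactFunctor (locFunctor X)) (zero_add i) =
    (Ext.mk₀ (actHom (Loc X)ᵐᵒᵖ (Quo (Loc.ext X P)) (Loc.of X r))).comp
      ((Ext.mk₀ (quoHom hX)).comp (e.mapExactFunctor (locFunctor X)) (zero_add i)) (zero_add i)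
  rw [Ext.mapExactFunctor_comp, Ext.mapExactFunctor_mk₀, Ext.mk₀_comp_mk₀_assoc,
    Ext.mk₀_comp_mk₀_assoc, actHom_quoHom]

/-- The natural map `Ext_R(R/P, M) ⊗ R_X → Ext_{R_X}(R_X/P_X, M ⊗ R_X)`, additively. -/
def locExtTensorAdd : NCTensor R (ExtGp Rᵐᵒᵖ (Quo P) M i) (Loc X) →+
    ExtGp (Loc X)ᵐᵒᵖ (Quo (Loc.ext X P)) (NCTensor R M (Loc X)) i :=
  NCTensor.lift
    (AddMonoidHom.mk' (fun e => AddMonoidHom.mk'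
      (fun x : Loc X => MulOpposite.op x • locExt hX M i e)
      fun x y => add_smul (MulOpposite.op x) (MulOpposite.op y) _)
      fun e e' => by
        ext x : 1
        change MulOpposite.op x • locExt hX M i (e + e') = MulOpposite.op x • locExt hX M i e +
          MulOpposite.op x • locExt hX M i e'
        rw [map_add, smul_add])
    (fun e r x => by
      change MulOpposite.op x • locExt hX M i (MulOpposite.op r • e) =
        MulOpposite.op (Loc.of X r * x) • locExt hX M i e
      rw [locExt_smul, ← mul_smul, MulOpposite.op_mul])

/-- The natural map `Ext_R(R/P, M) ⊗ R_X → Ext_{R_X}(R_X/P_X, M ⊗ R_X)`. -/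
def locExtTensor : NCTensor R (ExtGp Rᵐᵒᵖ (Quo P) M i) (Loc X) →ₗ[(Loc X)ᵐᵒᵖ]
    ExtGp (Loc X)ᵐᵒᵖ (Quo (Loc.ext X P)) (NCTensor R M (Loc X)) i where
  toFun := locExtTensorAdd hX M i
  map_add' := map_add _
  map_smul' y := DFunLike.congr_fun
    (f := (locExtTensorAdd hX M i).comp (DistribSMul.toAddMonoidHom _ y))
    (g := (DistribSMul.toAddMonoidHom _ y).comp (locExtTensorAdd hX M i))
    (NCTensor.hom_ext fun e x => mul_smul y (MulOpposite.op x) (locExt hX M i e))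

theorem locExtTensor_tmul (e : ExtGp Rᵐᵒᵖ (Quo P) M i) (x : Loc X) :
    locExtTensor hX M i (NCTensor.tmul R e x) = MulOpposite.op x • locExt hX M i e := rfl

variable {M}

/-- Naturality in the coefficients for classes of any degree, so that the squares with connecting
maps in the five lemma are included. -/
theorem locExtTensor_postcomp {M' : Type u} [AddCommGroup M'] [Module Rᵐᵒᵖ M'] {a b k : ℕ}
    (c : ExtGp Rᵐᵒᵖ M M' b) (h : a + b = k)
    (t : NCTensor R (ExtGp Rᵐᵒᵖ (Quo P) M a) (Loc X)) :
    locExtTensor hX M' k (NCTensor.map (extPostcomp R c h) LinearMap.id t) =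
      Ext.comp (locExtTensor hX M a t) (c.mapExactFunctor (locFunctor X)) h :=
  DFunLike.congr_fun
    (f := (locExtTensorAdd hX M' k).comp (NCTensor.map (extPostcomp R c h) LinearMap.id))
    (g := (AddMonoidHom.mk' (fun y : ExtGp (Loc X)ᵐᵒᵖ (Quo (Loc.ext X P))
        (NCTensor R M (Loc X)) a => y.comp (c.mapExactFunctor (locFunctor X)) h)
      fun _ _ => Ext.add_comp _ _ _ _).comp (locExtTensorAdd hX M a))
    (NCTensor.hom_ext fun e x => by
      change (Ext.mk₀ (actHom (Loc X)ᵐᵒᵖ (Quo (Loc.ext X P)) x)).comp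
          ((Ext.mk₀ (quoHom hX)).comp ((e.comp c h).mapExactFunctor (locFunctor X)) (zero_add k))
          (zero_add k) =
        ((Ext.mk₀ (actHom (Loc X)ᵐᵒᵖ (Quo (Loc.ext X P)) x)).comp
          ((Ext.mk₀ (quoHom hX)).comp (e.mapExactFunctor (locFunctor X)) (zero_add a))
          (zero_add a)).comp (c.mapExactFunctor (locFunctor X)) h
      rw [Ext.mapExactFunctor_comp, Ext.comp_assoc _ _ _ (zero_add a) h (by omega),
        Ext.comp_assoc _ _ _ (zero_add a) h (by omega)]) t

end Comparison

/-! ### Coefficients in R: localization on the left -/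

section Regular

instance : Module.Finite Rᵐᵒᵖ (Quo P) :=
  Module.Finite.of_surjective (LinearMap.toSpanSingleton Rᵐᵒᵖ (Quo P) 1) fun z => by
    obtain ⟨r, rfl⟩ := Quo.mk_surjective P z
    exact ⟨MulOpposite.op r, one_mul (Quo.mk P r)⟩

instance : Module.Finite (Loc X)ᵐᵒᵖ (Quo (Loc.ext X P)) :=
  Module.Finite.of_surjective (LinearMap.toSpanSingleton (Loc X)ᵐᵒᵖ (Quo (Loc.ext X P)) 1)
    fun z => by
      obtain ⟨r, rfl⟩ := Quo.mk_surjective _ z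
      exact ⟨MulOpposite.op r, one_mul (Quo.mk _ r)⟩

variable (q : ℕ)

/-- The natural map `Ext_R(R/P, R) → Ext_{R_X}(R_X/P_X, R_X)`. -/
def locExtSelf : ExtGp Rᵐᵒᵖ (Quo P) R q →+ ExtGp (Loc X)ᵐᵒᵖ (Quo (Loc.ext X P)) (Loc X) q :=
  AddMonoidHom.mk' (fun e => Ext.comp (locExt hX R q e) (Ext.mk₀ (lidHom X)) (add_zero q))
    fun e e' => by rw [map_add, Ext.add_comp]

theorem locExtSelf_smul (r : R) (e : ExtGp Rᵐᵒᵖ (Quo P) R q) :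
    locExtSelf hX q (MulOpposite.op r • e) = MulOpposite.op (Loc.of X r) • locExtSelf hX q e := by
  change Ext.comp (locExt hX R q (MulOpposite.op r • e)) (Ext.mk₀ (lidHom X)) (add_zero q) = _
  rw [locExt_smul]
  exact (extPostcomp (Loc X) (A := (Loc X)ᵐᵒᵖ) (D := NCTensor R R (Loc X)) (D' := Loc X)
    (Ext.mk₀ (lidHom X)) (add_zero q)).map_smul _ _

/-- The natural map `R_X ⊗ Ext_R(R/P, R) → Ext_{R_X}(R_X/P_X, R_X)`. -/
def tensorLocExtSelf : NCTensor R (Loc X) (ExtGp Rᵐᵒᵖ (Quo P) R q) →+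
    ExtGp (Loc X)ᵐᵒᵖ (Quo (Loc.ext X P)) (Loc X) q :=
  (Ext.precomp (Ext.mk₀ (quoHom hX)) (ModuleCat.of (Loc X)ᵐᵒᵖ (Loc X)) (zero_add q)).comp
    (extPairing (locFunctor X) (A := Rᵐᵒᵖ) (R := R) (F := Loc X) (D := R) (D' := Loc X) actLidHom
      actLidHom_smul (Quo P) q)

theorem tensorLocExtSelf_tmul (x : Loc X) (e : ExtGp Rᵐᵒᵖ (Quo P) R q) :
    tensorLocExtSelf hX q (NCTensor.tmul R x e) = x • locExtSelf hX q e := by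
  change (Ext.mk₀ (quoHom hX)).comp ((e.mapExactFunctor (locFunctor X)).comp (Ext.mk₀
      (lidHom X ≫ actHom (Loc X)ᵐᵒᵖ (Loc X) x)) (add_zero q)) (zero_add q) =
    (((Ext.mk₀ (quoHom hX)).comp (e.mapExactFunctor (locFunctor X)) (zero_add q)).comp
      (Ext.mk₀ (lidHom X)) (add_zero q)).comp (Ext.mk₀ (actHom (Loc X)ᵐᵒᵖ (Loc X) x)) (add_zero q)
  rw [Ext.comp_assoc_of_third_deg_zero, Ext.mk₀_comp_mk₀, Ext.comp_assoc_of_third_deg_zero]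

theorem tensorLocExtSelf_smul (x : Loc X) (t : NCTensor R (Loc X) (ExtGp Rᵐᵒᵖ (Quo P) R q)) :
    tensorLocExtSelf hX q (x • t) = x • tensorLocExtSelf hX q t :=
  DFunLike.congr_fun
    (f := (tensorLocExtSelf hX q).comp (DistribSMul.toAddMonoidHom _ x))
    (g := (DistribSMul.toAddMonoidHom _ x).comp (tensorLocExtSelf hX q))
    (NCTensor.hom_ext fun y e => by
      change tensorLocExtSelf hX q (NCTensor.tmul R (x * y) e) =
        x • tensorLocExtSelf hX q (NCTensor.tmul R y e)
      rw [tensorLocExtSelf_tmul, tensorLocExtSelf_tmul, mul_smul]) t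

/-- The left action comes from the coefficients, so flatness of R_X and finite generation of R/P
suffice; no correctness of P is involved. The isomorphism of R_X/P_X with R/P ⊗ R_X adjusts the
first variable. -/
theorem tensorLocExtSelf_bijective : Function.Bijective (tensorLocExtSelf hX q) := by
  have h1 : Function.Bijective (Ext.precomp (Ext.mk₀ (quoHom hX))
      (ModuleCat.of (Loc X)ᵐᵒᵖ (Loc X)) (zero_add q)) := by
    refine Function.bijective_iff_has_inverse.2 ⟨Ext.precomp (Ext.mk₀ (inv (quoHom hX)))
      (ModuleCat.of (Loc X)ᵐᵒᵖ (Loc X)) (zero_add q), fun y => ?_, fun y => ?_⟩ <;>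
    simp [Ext.mk₀_comp_mk₀_assoc]
  refine h1.comp (extPairing_bijective (locFunctor X) (A := Rᵐᵒᵖ) (R := R) (F := Loc X) (D := R)
    (D' := Loc X) actLidHom actLidHom_smul (Loc.isFlatRight X) _ (toSpanSingleton_loc_bijective X)
    (NCTensor.rid R (Loc X)) NCTensor.rid_bijective (fun x r => ?_) q (Quo P))
  change x * Loc.of X r = x * (Loc.of X ((1 : Rᵐᵒᵖ) • r) * 1)
  rw [one_smul, mul_one]

theorem exists_smul_eq_locExtSelf (n : ExtGp (Loc X)ᵐᵒᵖ (Quo (Loc.ext X P)) (Loc X) q) :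
    ∃ e, ∃ s ∈ X, Loc.of X s • n = locExtSelf hX q e := by
  obtain ⟨t, rfl⟩ := (tensorLocExtSelf_bijective hX q).2 n
  obtain ⟨e, s, hs, h⟩ := NCTensor.exists_smul_eq_one_tmul t
  exact ⟨e, s, hs, by rw [← tensorLocExtSelf_smul, h, tensorLocExtSelf_tmul, one_smul]⟩

theorem exists_smul_eq_zero_of_locExtSelf {e : ExtGp Rᵐᵒᵖ (Quo P) R q}
    (h : locExtSelf hX q e = 0) : ∃ s ∈ X, s • e = 0 := by
  refine NCTensor.exists_smul_eq_zero (X := X) ((injective_iff_map_eq_zero _).1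
    (tensorLocExtSelf_bijective hX q).1 _ ?_)
  rw [tensorLocExtSelf_tmul, one_smul, h]

end Regular

end

/-! ### Elements of a module as homomorphisms, and annihilation by P -/

section

open Abelian

theorem op_smul_ext_quo_eq_zero {R : Type u} [Ring R] {I : TwoSidedIdeal R} {M : Type u}
    [AddCommGroup M] [Module Rᵐᵒᵖ M] {i : ℕ} {p : R} (hp : p ∈ I)
    (e : ExtGp Rᵐᵒᵖ (Quo I) M i) : MulOpposite.op p • e = 0 := by
  have h : actHom Rᵐᵒᵖ (Quo I) p = 0 := ModuleCat.hom_ext <| LinearMap.ext fun x => by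
    change Quo.mk I p * x = 0
    rw [Quo.mk_eq_zero.2 hp, zero_mul]
  change Ext.comp (Ext.mk₀ (actHom Rᵐᵒᵖ (Quo I) p)) e (zero_add i) = 0
  rw [h, Ext.mk₀_zero, Ext.zero_comp]

theorem subsingleton_ext_of_lt_grade {A D M : Type u} [Ring A] [AddCommGroup D] [Module A D]
    [AddCommGroup M] [Module A M] {i : ℕ} (h : (i : ℕ∞) < grade A D M) :
    Subsingleton (ExtGp A M D i) := by
  by_contra hn
  rw [not_subsingleton_iff_nontrivial] at hn
  exact absurd h (not_lt.2 (iInf₂_le i hn))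

theorem comp_mk₀_comp_mk₀ {A : Type u} [Ring A] {X Y Z W : ModuleCat.{u} A} {n : ℕ}
    (e : Ext X Y n) (f : Y ⟶ Z) (g : Z ⟶ W) :
    (e.comp (Ext.mk₀ f) (add_zero n)).comp (Ext.mk₀ g) (add_zero n) =
      e.comp (Ext.mk₀ (f ≫ g)) (add_zero n) := by
  rw [Ext.comp_assoc_of_third_deg_zero, Ext.mk₀_comp_mk₀]

variable {R : Type u} [Ring R]

section ElemHom

variable {F : Type u} [AddCommGroup F] [Module Rᵐᵒᵖ F]

variable (F) in
/-- An element `f` of a right module `F`, as the homomorphism `r ↦ f r`. -/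
def elemHom : F →+ (ModuleCat.of Rᵐᵒᵖ R ⟶ ModuleCat.of Rᵐᵒᵖ F) :=
  AddMonoidHom.mk' (fun f => ModuleCat.ofHom
    { toFun := fun r => MulOpposite.op r • f
      map_add' := fun r s => add_smul (MulOpposite.op r) (MulOpposite.op s) f
      map_smul' := fun s r => mul_smul s (MulOpposite.op r) f })
    fun f f' => ModuleCat.hom_ext <| LinearMap.ext fun r => smul_add (MulOpposite.op r) f f'

theorem elemHom_smul (f : F) (r : R) :
    elemHom F (MulOpposite.op r • f) = actHom Rᵐᵒᵖ R r ≫ elemHom F f :=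
  ModuleCat.hom_ext <| LinearMap.ext fun s =>
    (mul_smul (MulOpposite.op s) (MulOpposite.op r) f).symm

theorem toSpanSingleton_one_bijective (A : Type u) [Ring A] :
    Function.Bijective (LinearMap.toSpanSingleton A A 1) :=
  ⟨fun a b h => by simpa using h, fun a => ⟨a, by simp⟩⟩

/-- The pairing along the identity functor identifies F ⊗ Ext(R/P, R) with Ext(R/P, F). -/
theorem elemHom_extPairing_bijective [IsNoetherianRing Rᵐᵒᵖ] {P : TwoSidedIdeal R}
    (hF : IsFlatRight R F) (q : ℕ) :
    Function.Bijective (extPairing (𝟭 (ModuleCat.{u} Rᵐᵒᵖ)) (D := R) (D' := F) (elemHom F)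
      elemHom_smul (Quo P) q) :=
  extPairing_bijective (𝟭 (ModuleCat.{u} Rᵐᵒᵖ)) (D := R) (D' := F) (elemHom F)
    elemHom_smul hF (1 : Rᵐᵒᵖ) (toSpanSingleton_one_bijective Rᵐᵒᵖ) (NCTensor.rid R F)
    NCTensor.rid_bijective (fun f r => by
      change MulOpposite.op r • f = MulOpposite.op (r * 1) • f
      rw [mul_one]) q (Quo P)

variable [IsNoetherianRing R] {X : Submonoid R} [IsOreSet X]

variable (F X) in
/-- An element `f` of a right module `F`, as the homomorphism `x ↦ f ⊗ x`. -/
def tmulHom : F →+ (ModuleCat.of (Loc X)ᵐᵒᵖ (Loc X) ⟶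
    ModuleCat.of (Loc X)ᵐᵒᵖ (NCTensor R F (Loc X))) :=
  AddMonoidHom.mk' (fun f => ModuleCat.ofHom
    { toFun := fun x => NCTensor.tmul R f x
      map_add' := NCTensor.tmul_add f
      map_smul' := fun _ _ => rfl })
    fun f f' => ModuleCat.hom_ext <| LinearMap.ext fun x => NCTensor.add_tmul f f' x

theorem tmulHom_smul (f : F) (r : R) :
    tmulHom F X (MulOpposite.op r • f) = actHom (Loc X)ᵐᵒᵖ (Loc X) r ≫ tmulHom F X f :=
  ModuleCat.hom_ext <| LinearMap.ext fun x => NCTensor.smul_tmul f r x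

theorem map_elemHom (f : F) :
    (locFunctor X).map (elemHom F f) = lidHom X ≫ tmulHom F X f :=
  ModuleCat.hom_ext <| LinearMap.ext <| DFunLike.congr_fun
    (f := NCTensor.map (elemHom F f).hom LinearMap.id)
    (g := (AddMonoidHom.mk' (NCTensor.tmul R f) (NCTensor.tmul_add f)).comp
      (NCTensor.lid R (Loc X)))
    (NCTensor.hom_ext fun r x => NCTensor.smul_tmul f r x)

end ElemHom

variable [IsNoetherianRing R]
  {X : Submonoid R} [IsOreSet X] {P : TwoSidedIdeal R} (hX : X ≤ regularMod P)

include hX in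
-- Write z = p y with p in P and move p across the tensor sign, where it kills `e`.
theorem tmul_eq_zero_of_mem_ext {M : Type u} [AddCommGroup M] [Module Rᵐᵒᵖ M]
    {q : ℕ} {z : Loc X} (hz : z ∈ Loc.ext X P) (e : ExtGp Rᵐᵒᵖ (Quo P) M q) :
    NCTensor.tmul R e z = 0 := by
  obtain ⟨p, hp, y, rfl⟩ := Loc.exists_eq_mul_of_mem_ext hX hz
  have := NCTensor.smul_tmul e p y
  rw [op_smul_ext_quo_eq_zero hp, NCTensor.zero_tmul] at this
  exact this.symm

variable [IsNoetherianRing Rᵐᵒᵖ]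

/-! ### Coefficients in R: localization on the right -/

section Regular

variable (q : ℕ)

/-- The natural map `Ext_R(R/P, R) ⊗ R_X → Ext_{R_X}(R_X/P_X, R_X)`. -/
def locExtTensorSelf : NCTensor R (ExtGp Rᵐᵒᵖ (Quo P) R q) (Loc X) →ₗ[R]
    ExtGp (Loc X)ᵐᵒᵖ (Quo (Loc.ext X P)) (Loc X) q where
  toFun t := Ext.comp (locExtTensor hX R q t) (Ext.mk₀ (lidHom X)) (add_zero q)
  map_add' t t' := by rw [map_add, Ext.add_comp]
  map_smul' r t := by
    have h := locExtTensor_postcomp hX (Ext.mk₀ (actHom Rᵐᵒᵖ R r)) (add_zero q) t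
    rw [Ext.mapExactFunctor_mk₀] at h
    change Ext.comp (locExtTensor hX R q (NCTensor.map (extPostcomp R
      (Ext.mk₀ (actHom Rᵐᵒᵖ R r)) (add_zero q)) LinearMap.id t)) (Ext.mk₀ (lidHom X))
      (add_zero q) = (Ext.comp (locExtTensor hX R q t) (Ext.mk₀ (lidHom X)) (add_zero q)).comp
        (Ext.mk₀ (actHom (Loc X)ᵐᵒᵖ (Loc X) (Loc.of X r))) (add_zero q)
    rw [h]
    refine (comp_mk₀_comp_mk₀ (locExtTensor hX R q t) _ (lidHom X)).trans ((congrArg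
      (fun g : (locFunctor X).obj (ModuleCat.of Rᵐᵒᵖ R) ⟶ ModuleCat.of (Loc X)ᵐᵒᵖ (Loc X) =>
        Ext.comp (locExtTensor hX R q t) (Ext.mk₀ g) (add_zero q)) (map_actHom_lidHom r)).trans ?_)
    exact (comp_mk₀_comp_mk₀ (locExtTensor hX R q t) (lidHom X) _).symm

theorem locExtTensorSelf_apply (t : NCTensor R (ExtGp Rᵐᵒᵖ (Quo P) R q) (Loc X)) :
    locExtTensorSelf hX q t =
      Ext.comp (locExtTensor hX R q t) (Ext.mk₀ (lidHom X)) (add_zero q) := rfl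

theorem locExtTensorSelf_op_smul (y : (Loc X)ᵐᵒᵖ)
    (t : NCTensor R (ExtGp Rᵐᵒᵖ (Quo P) R q) (Loc X)) :
    locExtTensorSelf hX q (y • t) = y • locExtTensorSelf hX q t := by
  rw [locExtTensorSelf_apply, map_smul]
  exact (extPostcomp (Loc X) (A := (Loc X)ᵐᵒᵖ) (D := NCTensor R R (Loc X)) (D' := Loc X)
    (Ext.mk₀ (lidHom X)) (add_zero q)).map_smul _ _

theorem locExtTensorSelf_tmul_one (e : ExtGp Rᵐᵒᵖ (Quo P) R q) :
    locExtTensorSelf hX q (NCTensor.tmul R e 1) = locExtSelf hX q e := by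
  rw [locExtTensorSelf_apply, locExtTensor_tmul, MulOpposite.op_one, one_smul]
  rfl

/-- The target is the left localization of Ext_R(R/P, R). A class with zero image is thus killed on
the left by some s' in `X`, and injectivity of s' on the tensor product makes it vanish there. Every
target element is a left fraction s⁻¹e, and surjectivity of s supplies the preimage. -/
theorem locExtTensorSelf_bijective_of_smul_bijective
    (h : ∀ s ∈ X, Function.Bijective
      fun t : NCTensor R (ExtGp Rᵐᵒᵖ (Quo P) R q) (Loc X) => s • t) :
    Function.Bijective (locExtTensorSelf hX q) := by
  constructor
  · refine (injective_iff_map_eq_zero _).2 fun t ht => ?_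
    obtain ⟨e, s, hs, he⟩ := NCTensor.exists_smul_eq_tmul_one t
    have h1 : locExtSelf hX q e = 0 := by
      rw [← locExtTensorSelf_tmul_one, ← he, locExtTensorSelf_op_smul, ht, smul_zero]
    obtain ⟨s', hs', h2⟩ := exists_smul_eq_zero_of_locExtSelf hX q h1
    refine NCTensor.eq_zero_of_smul_op hs ((h s' hs').1 ?_)
    change s' • _ = s' • (0 : NCTensor R (ExtGp Rᵐᵒᵖ (Quo P) R q) (Loc X))
    rw [he, smul_zero]
    change NCTensor.tmul R (s' • e) 1 = 0
    rw [h2, NCTensor.zero_tmul]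
  · intro n
    obtain ⟨e, s, hs, he⟩ := exists_smul_eq_locExtSelf hX q n
    obtain ⟨t, ht⟩ := (h s hs).2 (NCTensor.tmul R e 1)
    refine ⟨t, sub_eq_zero.1 (NCTensor.eq_zero_of_smul hs ?_)⟩
    have h1 : Loc.of X s • locExtTensorSelf hX q t = locExtTensorSelf hX q (s • t) :=
      ((locExtTensorSelf hX q).map_smul s t).symm
    rw [smul_sub, h1, he, sub_eq_zero, ← locExtTensorSelf_tmul_one]
    exact congrArg _ ht

theorem subsingleton_ext_loc
    (h : ∀ e : ExtGp Rᵐᵒᵖ (Quo P) R q, locExtSelf hX q e = 0) :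
    Subsingleton (ExtGp (Loc X)ᵐᵒᵖ (Quo (Loc.ext X P)) (Loc X) q) := by
  refine subsingleton_of_forall_eq 0 fun n => ?_
  obtain ⟨e, s, hs, he⟩ := exists_smul_eq_locExtSelf hX q n
  exact NCTensor.eq_zero_of_smul hs (he.trans (h e))

theorem locExtTensorSelf_bijective_of_torsion [IsArtinianRing (Quo (Loc.ext X P))]
    (h : ∀ e : ExtGp Rᵐᵒᵖ (Quo P) R q, ∃ c ∈ regularMod P, MulOpposite.op c • e = 0) :
    Function.Bijective (locExtTensorSelf hX q) := by
  have h1 : Subsingleton (ExtGp (Loc X)ᵐᵒᵖ (Quo (Loc.ext X P)) (Loc X) q) := by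
    refine subsingleton_ext_loc hX q fun e => ?_
    obtain ⟨c, hc, hce⟩ := h e
    -- Modulo P_X the element c is invertible, and P_X kills the Ext group; a class killed by c is
    -- therefore zero.
    obtain ⟨y, hy⟩ := Loc.exists_mul_sub_one_mem_ext hX hc
    have h2 := op_smul_ext_quo_eq_zero hy (locExtSelf hX q e)
    rw [MulOpposite.op_sub, sub_smul, MulOpposite.op_mul, mul_smul, ← locExtSelf_smul, hce,
      map_zero, smul_zero, zero_sub, MulOpposite.op_one, one_smul, neg_eq_zero] at h2
    exact h2
  have h2 : Subsingleton (NCTensor R (ExtGp Rᵐᵒᵖ (Quo P) R q) (Loc X)) := by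
    refine subsingleton_of_forall_eq 0 fun t => ?_
    obtain ⟨e, s, hs, he⟩ := NCTensor.exists_smul_eq_tmul_one t
    refine NCTensor.eq_zero_of_smul_op hs (he.trans ?_)
    obtain ⟨c, hc, hce⟩ := h e
    obtain ⟨y, hy⟩ := Loc.exists_mul_sub_one_mem_ext hX hc
    have h3 := NCTensor.smul_tmul e c y
    rw [hce, NCTensor.zero_tmul] at h3
    have h4 : NCTensor.tmul R e (c • y - (Loc.of X c * y - 1)) = 0 := by
      rw [sub_eq_add_neg, NCTensor.tmul_add, ← h3, zero_add]
      exact tmul_eq_zero_of_mem_ext hX (TwoSidedIdeal.neg_mem _ hy) e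
    rw [show c • y = Loc.of X c * y from rfl, sub_sub_cancel] at h4
    exact h4
  exact ⟨Function.injective_of_subsingleton _, fun y => ⟨0, Subsingleton.elim _ _⟩⟩

theorem locExtTensorSelf_bijective_of_subsingleton
    [Subsingleton (ExtGp Rᵐᵒᵖ (Quo P) R q)] :
    Function.Bijective (locExtTensorSelf hX q) := by
  have h1 := subsingleton_ext_loc hX q fun e => by rw [Subsingleton.elim e 0, map_zero]
  have h2 := NCTensor.subsingleton_left (R := R) (M := ExtGp Rᵐᵒᵖ (Quo P) R q) (N := Loc X)
  exact ⟨Function.injective_of_subsingleton _, fun y => ⟨0, Subsingleton.elim _ _⟩⟩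

end Regular

/-! ### Flat coefficients -/

section Flat

variable {F : Type u} [AddCommGroup F] [Module Rᵐᵒᵖ F]

theorem tmulHom_extPairing_bijective (hF : IsFlatRight R F) (q : ℕ) :
    Function.Bijective (extPairing (𝟭 (ModuleCat.{u} (Loc X)ᵐᵒᵖ)) (D := Loc X)
      (D' := NCTensor R F (Loc X)) (tmulHom F X) tmulHom_smul (Quo (Loc.ext X P)) q) :=
  extPairing_bijective (𝟭 (ModuleCat.{u} (Loc X)ᵐᵒᵖ)) (D := Loc X)
    (D' := NCTensor R F (Loc X)) (tmulHom F X) tmulHom_smul hF (1 : (Loc X)ᵐᵒᵖ)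
    (toSpanSingleton_one_bijective (Loc X)ᵐᵒᵖ) (AddMonoidHom.id _) Function.bijective_id
    (fun f x => by
      change NCTensor.tmul R f x = NCTensor.tmul R f (x * 1)
      rw [mul_one]) q (Quo (Loc.ext X P))

variable (F) in
/-- The map `F ⊗ (Ext_R(R/P, R) ⊗ R_X) → Ext_R(R/P, F) ⊗ R_X`. -/
def tensorExtTensor (q : ℕ) : NCTensor R F (NCTensor R (ExtGp Rᵐᵒᵖ (Quo P) R q) (Loc X)) →+
    NCTensor R (ExtGp Rᵐᵒᵖ (Quo P) F q) (Loc X) :=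
  NCTensor.lift
    (AddMonoidHom.mk' (fun f => NCTensor.map
      (extPostcomp R (Ext.mk₀ (elemHom F f)) (add_zero q)) LinearMap.id)
      fun f f' => NCTensor.hom_ext fun e x => by
        change NCTensor.tmul R (Ext.comp e (Ext.mk₀ (elemHom F (f + f'))) (add_zero q)) x =
          NCTensor.tmul R (Ext.comp e (Ext.mk₀ (elemHom F f)) (add_zero q)) x +
          NCTensor.tmul R (Ext.comp e (Ext.mk₀ (elemHom F f')) (add_zero q)) x
        rw [← NCTensor.add_tmul, map_add, Ext.mk₀_add, Ext.comp_add])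
    fun f r t => DFunLike.congr_fun
      (f := NCTensor.map (extPostcomp R (Ext.mk₀ (elemHom F (MulOpposite.op r • f)))
        (add_zero q)) LinearMap.id)
      (g := (NCTensor.map (extPostcomp R (Ext.mk₀ (elemHom F f)) (add_zero q))
        LinearMap.id).comp (DistribSMul.toAddMonoidHom
          (NCTensor R (ExtGp Rᵐᵒᵖ (Quo P) R q) (Loc X)) r))
      (NCTensor.hom_ext fun e x => by
        change NCTensor.tmul R (Ext.comp e (Ext.mk₀ (elemHom F (MulOpposite.op r • f)))
            (add_zero q)) x =
          NCTensor.tmul R (Ext.comp (Ext.comp e (Ext.mk₀ (actHom Rᵐᵒᵖ R r)) (add_zero q))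
            (Ext.mk₀ (elemHom F f)) (add_zero q)) x
        rw [elemHom_smul, Ext.comp_assoc_of_third_deg_zero, Ext.mk₀_comp_mk₀]) t

/-- Only surjectivity is proved directly; injectivity comes later from a bijective composite. -/
theorem tensorExtTensor_surjective (hF : IsFlatRight R F) (q : ℕ) :
    Function.Surjective (tensorExtTensor (X := X) (P := P) F q) := by
  intro t
  induction t using NCTensor.induction_on with
  | h0 => exact ⟨0, map_zero _⟩
  | ht e x =>
    obtain ⟨z, rfl⟩ := (elemHom_extPairing_bijective hF q).2 e
    induction z using NCTensor.induction_on with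
    | h0 => exact ⟨0, by rw [map_zero, map_zero, NCTensor.zero_tmul]⟩
    | ht f e =>
      refine ⟨NCTensor.tmul R f (NCTensor.tmul R e x), ?_⟩
      rw [extPairing_tmul, mapExactFunctor_id]
      rfl
    | ha z z' hz hz' =>
      obtain ⟨w, hw⟩ := hz
      obtain ⟨w', hw'⟩ := hz'
      exact ⟨w + w', by rw [map_add, hw, hw', map_add, NCTensor.add_tmul]⟩
  | ha t t' ht ht' =>
    obtain ⟨w, rfl⟩ := ht
    obtain ⟨w', rfl⟩ := ht'
    exact ⟨w + w', map_add _ _ _⟩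

theorem locExtTensor_bijective_of_flat (hF : IsFlatRight R F) (q : ℕ)
    (h : Function.Bijective (locExtTensorSelf (P := P) hX q)) :
    Function.Bijective (locExtTensor (P := P) hX F q) := by
  -- The two routes from F ⊗ (Ext_R(R/P, R) ⊗ R_X) to Ext over R_X agree. The other route is F
  -- tensored with the comparison map for R, followed by the pairing over R_X; both are bijective.
  have hcomp : (locExtTensorAdd hX F q).comp (tensorExtTensor F q) =
      (extPairing (𝟭 (ModuleCat.{u} (Loc X)ᵐᵒᵖ)) (D := Loc X)
        (D' := NCTensor R F (Loc X)) (tmulHom F X) tmulHom_smul (Quo (Loc.ext X P)) q).comp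
      (NCTensor.map LinearMap.id (locExtTensorSelf hX q)) := NCTensor.hom_ext fun f t => by
    have h1 := locExtTensor_postcomp hX (Ext.mk₀ (elemHom F f)) (add_zero q) t
    rw [Ext.mapExactFunctor_mk₀, map_elemHom] at h1
    refine h1.trans ?_
    change _ = (Ext.mapExactFunctor (𝟭 _) (locExtTensorSelf hX q t)).comp
      (Ext.mk₀ (tmulHom F X f)) (add_zero q)
    rw [mapExactFunctor_id, locExtTensorSelf_apply]
    exact (comp_mk₀_comp_mk₀ (locExtTensor hX R q t) (lidHom X) (tmulHom F X f)).symm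
  have h1 : Function.Bijective ((locExtTensorAdd hX F q).comp (tensorExtTensor F q)) := by
    rw [hcomp]
    exact (tmulHom_extPairing_bijective hF q).comp (NCTensor.map_bijective _ h)
  have h2 : Function.Bijective (tensorExtTensor (X := X) (P := P) F q) :=
    ⟨Function.Injective.of_comp h1.1, tensorExtTensor_surjective hF q⟩
  exact (Function.Bijective.of_comp_iff _ h2).1 h1

end Flat

theorem locExtTensor_bijective_of_hasFlatResolution
    (h : ∀ q, Function.Bijective (locExtTensorSelf (P := P) hX q)) (n : ℕ)
    (M : ModuleCat.{u} Rᵐᵒᵖ) (hM : HasFlatResolution R n M) (i : ℕ) :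
    Function.Bijective (locExtTensor (P := P) hX M i) := by
  induction n generalizing M i with
  | zero => exact locExtTensor_bijective_of_flat hX hM i (h i)
  | succ n ih =>
    obtain ⟨K, F, f, p, hF, hf, hfp, hp, hK⟩ := hM
    have hS : (ShortComplex.mk (ModuleCat.ofHom f) (ModuleCat.ofHom p)
        (ModuleCat.hom_ext hfp.linearMap_comp_eq_zero)).ShortExact :=
      .mk' ((ShortComplex.ShortExact.moduleCat_exact_iff_function_exact _).2 hfp)
        ((ModuleCat.mono_iff_injective _).2 hf) ((ModuleCat.epi_iff_surjective _).2 hp)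
    have hLS := hS.map_of_exact (locFunctor X)
    let Q := ModuleCat.of Rᵐᵒᵖ (Quo P)
    let Q' := ModuleCat.of (Loc X)ᵐᵒᵖ (Quo (Loc.ext X P))
    have hFi := fun i => locExtTensor_bijective_of_flat hX hF i (h i)
    -- Five lemma with the terms K, F, M in degree i and K, F in degree i + 1; the induction
    -- therefore runs over all degrees at once.
    refine AddMonoidHom.bijective_of_surjective_of_bijective_of_bijective_of_injective
      (NCTensor.map (extPostcomp (N := Quo P) R (Ext.mk₀ (ModuleCat.ofHom f)) (add_zero i))
        LinearMap.id)
      (NCTensor.map (extPostcomp R (Ext.mk₀ (ModuleCat.ofHom p)) (add_zero i)) LinearMap.id)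
      (NCTensor.map (extPostcomp R hS.extClass rfl) LinearMap.id)
      (NCTensor.map (extPostcomp R (Ext.mk₀ (ModuleCat.ofHom f)) (add_zero (i + 1)))
        LinearMap.id)
      ((Ext.mk₀ ((locFunctor X).map (ModuleCat.ofHom f))).postcomp Q' (add_zero i))
      ((Ext.mk₀ ((locFunctor X).map (ModuleCat.ofHom p))).postcomp Q' (add_zero i))
      (hLS.extClass.postcomp Q' rfl)
      ((Ext.mk₀ ((locFunctor X).map (ModuleCat.ofHom f))).postcomp Q' (add_zero (i + 1)))
      (locExtTensorAdd hX K i) (locExtTensorAdd hX F i) (locExtTensorAdd hX M i)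
      (locExtTensorAdd hX K (i + 1)) (locExtTensorAdd hX F (i + 1))
      ?_ ?_ ?_ ?_ ?_ ?_ ?_ ?_ ?_ ?_ (ih K hK i).2 (hFi i) (ih K hK (i + 1)) (hFi (i + 1)).1
    · ext t
      exact (Ext.mapExactFunctor_mk₀ (locFunctor X) (ModuleCat.ofHom f) ▸
        locExtTensor_postcomp hX _ _ t).symm
    · ext t
      exact (Ext.mapExactFunctor_mk₀ (locFunctor X) (ModuleCat.ofHom p) ▸
        locExtTensor_postcomp hX _ _ t).symm
    · ext t
      exact (Ext.mapExactFunctor_extClass (locFunctor X) hS ▸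
        locExtTensor_postcomp hX _ _ t).symm
    · ext t
      exact (Ext.mapExactFunctor_mk₀ (locFunctor X) (ModuleCat.ofHom f) ▸
        locExtTensor_postcomp hX _ _ t).symm
    · exact NCTensor.map_exact_loc _ _ ((ShortComplex.ab_exact_iff_function_exact _).1
        (Ext.covariant_sequence_exact₂' Q hS i))
    · exact NCTensor.map_exact_loc _ _ ((ShortComplex.ab_exact_iff_function_exact _).1
        (Ext.covariant_sequence_exact₃' Q hS i (i + 1) rfl))
    · exact NCTensor.map_exact_loc _ _ ((ShortComplex.ab_exact_iff_function_exact _).1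
        (Ext.covariant_sequence_exact₁' Q hS i (i + 1) rfl))
    · exact (ShortComplex.ab_exact_iff_function_exact _).1
        (Ext.covariant_sequence_exact₂' Q' hLS i)
    · exact (ShortComplex.ab_exact_iff_function_exact _).1
        (Ext.covariant_sequence_exact₃' Q' hLS i (i + 1) rfl)
    · exact (ShortComplex.ab_exact_iff_function_exact _).1
        (Ext.covariant_sequence_exact₁' Q' hLS i (i + 1) rfl)

theorem cliqueSet_clique_le {R : Type u} [Ring R] (P : TwoSidedIdeal R) :
    cliqueSet (clique P) ≤ regularMod P :=
  iInf₂_le P (Relation.EqvGen.refl P)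

theorem IsRightLocalizablyCorrect.locExtTensorSelf_bijective {R : Type u} [Ring R]
    [IsNoetherianRing R] [IsNoetherianRing Rᵐᵒᵖ] {P : TwoSidedIdeal R}
    [IsOreSet (cliqueSet (clique P))] (hP : IsRightLocalizablyCorrect P) (q : ℕ) :
    Function.Bijective (locExtTensorSelf (cliqueSet_clique_le P) q) := by
  rcases lt_trichotomy (q : ℕ∞) (grade Rᵐᵒᵖ R (Quo P)) with h | h | h
  · have := subsingleton_ext_of_lt_grade h
    exact locExtTensorSelf_bijective_of_subsingleton _ q
  · obtain ⟨φ, hφ⟩ := hP.bimodule_right q h.symm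
    refine locExtTensorSelf_bijective_of_smul_bijective _ q fun s hs => ?_
    obtain ⟨u, hu⟩ := Loc.isUnit_of hs
    -- Through φ the left action of s becomes that of a unit of R_X. Only this consequence of φ is
    -- used, so φ need not be the natural map.
    refine (Function.Bijective.of_comp_iff' φ.bijective _).1 ?_
    have h1 : (φ ∘ fun t => s • t) = (fun y => u • y) ∘ φ := funext fun t => by
      change φ (s • t) = (↑u : Loc (cliqueSet (clique P))) • φ t
      rw [hφ, hu]
    rw [h1]
    exact (MulAction.bijective u).comp φ.bijective
  · have := (hP.localizable.simple_artinian P (Relation.EqvGen.refl P)).2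
    exact locExtTensorSelf_bijective_of_torsion _ q (hP.correct q h)

end

end LocExt

end

open LocExt in
theorem mainTheorem1 (R : Type u) [Ring R] [IsAuslanderGorenstein R] (hR : IsGradeSymmetric R)
    (P : TwoSidedIdeal R) (hP : IsPrimeIdeal P) [IsOreSet (cliqueSet (clique P))]
    (hPc : IsRightLocalizablyCorrect P)
    (M : Type u) [AddCommGroup M] [Module Rᵐᵒᵖ M] (hM : HasFiniteFlatDim R M) (i : ℕ) :
    (∀ p ∈ P, ∀ t : NCTensor R (ExtGp Rᵐᵒᵖ (Quo P) M i) (Loc (cliqueSet (clique P))),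
      MulOpposite.op (Loc.of (cliqueSet (clique P)) p) • t = 0) ∧
    Nonempty
      (NCTensor R (ExtGp Rᵐᵒᵖ (Quo P) M i) (Loc (cliqueSet (clique P)))
          ≃ₗ[(Loc (cliqueSet (clique P)))ᵐᵒᵖ]
        ExtGp (Loc (cliqueSet (clique P)))ᵐᵒᵖ (Quo (Loc.ext (cliqueSet (clique P)) P))
          (NCTensor R M (Loc (cliqueSet (clique P)))) i) := by
  have hX := cliqueSet_clique_le P
  obtain ⟨n, hn⟩ := hM
  refine ⟨fun p hp t => ?_, ⟨LinearEquiv.ofBijective (locExtTensor hX M i)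
    (locExtTensor_bijective_of_hasFlatResolution hX hPc.locExtTensorSelf_bijective n _ hn i)⟩⟩
  induction t using NCTensor.induction_on with
  | h0 => exact smul_zero _
  | ht e x =>
    -- Acting by p on e ⊗ x gives e ⊗ x p, and x p lies in P_X because P_X is two-sided.
    exact tmul_eq_zero_of_mem_ext hX
      (TwoSidedIdeal.mul_mem_left _ x _ (Loc.of_mem_ext hp)) e
  | ha t t' ht ht' => rw [smul_add, ht, ht', add_zero]
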